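/- Let $\mathbb{M}$ be a complete finite-dimensional smooth Riemannian manifold (without boundary, and connected, so that the Riemannian distance $d$ is finite), equipped with its Levi-Civita connection $\nabla$; complete means that all geodesics are defined on the whole of $\mathbb{R}$. For $p\in\mathbb{M}$ let $\exp_p:T_p\mathbb{M}\to\mathbb{M}$ be the exponential map, let $i_p\in(0,\infty]$ be the injectivity radius at $p$, i.e. the supremum of all $r>0$ such that $\exp_p$ restricted to the open ball of radius $r$ around the origin of $T_p\mathbb{M}$ is a diffeomorphism onto an open subset of $\mathbb{M}$, and let $B_\delta(p)=\{q\in\mathbb{M}: d(p,q)<\delta\}$. A geodesic segment joining $p$ to $q$ is called minimal if its length equals $d(p,q)$; geodesic segments are parametrized by $[0,1]$. Let $\bar p\in\mathbb{M}$, $0<\delta<i_{\bar p}$ and $u\in T_{\bar p}\mathbb{M}$. Then for every $p\in B_\delta(\bar p)$ there is exactly one minimal geodesic segment $\gamma_p:[0,1]\to\mathbb{M}$ joining $\bar p$ to $p$, and the parallel transport $P_{\bar pp}u\in T_p\mathbb{M}$ of $u$ along $\gamma_p$ is well defined: there is exactly one $w\in T_p\mathbb{M}$ such that $w=V(1)$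 for a vector field $V$ along $\gamma_p$ with $\nabla_{\gamma_p'}V=0$ on $[0,1]$ and $V(0)=u$, and $P_{\bar pp}u:=w$. Moreover, the vector field $F:B_\delta(\bar p)\to T\mathbb{M}$, $F(p):=P_{\bar pp}u$, is continuous. -/

import Mathlib

open Set Bundle Manifold
open scoped ContDiff Topology ENNReal NNReal

noncomputable section

namespace RiemTransport

variable {E : Type*} [NormedAddCommGroup E] [NormedSpace ℝ E]
  {M : Type*} [MetricSpace M] [ChartedSpace E M]

/-- The differential at `y : E` of the inverse of the chart around `x₀`: it sends a coordinate
vector `a = (a¹, …, aⁿ)` to `∑ aⁱ ∂ᵢ` at the point with coordinates `y`. -/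
def coordFrame (x₀ : M) (y : E) :
    E →L[ℝ] TangentSpace 𝓘(ℝ, E) ((extChartAt 𝓘(ℝ, E) x₀).symm y) :=
  mfderiv 𝓘(ℝ, E) 𝓘(ℝ, E) (extChartAt 𝓘(ℝ, E) x₀).symm y

/-- The differential at `x : M` of the chart around `x₀`: it sends a tangent vector to its
components in the coordinate basis. -/
def coordOf (x₀ x : M) (v : TangentSpace 𝓘(ℝ, E) x) : E :=
  mfderiv 𝓘(ℝ, E) 𝓘(ℝ, E) (extChartAt 𝓘(ℝ, E) x₀) x v

/-- The velocity `γ'(t)` of a curve. -/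
def velocity (γ : ℝ → M) (t : ℝ) : TangentSpace 𝓘(ℝ, E) (γ t) :=
  mfderiv 𝓘(ℝ, ℝ) 𝓘(ℝ, E) γ t (1 : ℝ)

variable [RiemannianBundle (fun x : M ↦ TangentSpace 𝓘(ℝ, E) x)]

/-- The metric tensor `g_{ij}(y)` in the chart around `x₀`, as a bilinear form on `E`. -/
def metricInChart (x₀ : M) (y : E) : E →L[ℝ] E →L[ℝ] ℝ :=
  (innerSL ℝ (E := TangentSpace 𝓘(ℝ, E) ((extChartAt 𝓘(ℝ, E) x₀).symm y))).bilinearComp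
    (coordFrame x₀ y) (coordFrame x₀ y)

/-- The Christoffel symbols of the first kind in the chart around `x₀`: the linear form
`w ↦ ½ (∂_a g(b, w) + ∂_b g(a, w) - ∂_w g(a, b))`. -/
def christoffelFirst (x₀ : M) (y a b : E) : E →L[ℝ] ℝ :=
  (1 / 2 : ℝ) • (fderiv ℝ (metricInChart x₀) y a b + fderiv ℝ (metricInChart x₀) y b a
    - ((fderiv ℝ (metricInChart x₀) y).flip a).flip b)

/-- The Christoffel symbols of the Levi-Civita connection in the chart around `x₀`:
the vector with components
`Γᵏᵢⱼ aⁱ bʲ = ½ gᵏˡ (∂ᵢ g_{jl} + ∂ⱼ g_{il} - ∂ₗ g_{ij}) aⁱ bʲ` at `y`. -/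
def christoffel (x₀ : M) (y a b : E) : E :=
  (metricInChart x₀ y).inverse (christoffelFirst x₀ y a b)

/-- The covariant derivative `∇_{γ'} V` at time `t ∈ s`, for the Levi-Civita connection, of a
vector field `V` along a curve `γ` defined on the interval `s`. It is computed in the chart around
`γ t` as `dVᵏ/dt + Γᵏᵢⱼ (dγⁱ/dt) Vʲ`; since the differential of that chart at `γ t` is the
identification of the tangent space with `E`, the result is a tangent vector at `γ t`. -/
def covDerivAlong (s : Set ℝ) (γ : ℝ → M) (V : ∀ t, TangentSpace 𝓘(ℝ, E) (γ t)) (t : ℝ) :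
    TangentSpace 𝓘(ℝ, E) (γ t) :=
  (derivWithin (F := E) (fun r ↦ coordOf (γ t) (γ r) (V r)) s t
    + christoffel (γ t) (extChartAt 𝓘(ℝ, E) (γ t) (γ t))
        (derivWithin (fun r ↦ extChartAt 𝓘(ℝ, E) (γ t) (γ r)) s t)
        (coordOf (γ t) (γ t) (V t)) : E)

variable [IsManifold 𝓘(ℝ, E) ∞ M]

/-- The vector field `V` along `γ` is (differentiable and) parallel on the interval `s`. -/
def IsParallelOn (s : Set ℝ) (γ : ℝ → M) (V : ∀ t, TangentSpace 𝓘(ℝ, E) (γ t)) : Prop :=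
  MDifferentiableOn 𝓘(ℝ, ℝ) 𝓘(ℝ, E).tangent
      (fun t ↦ (⟨γ t, V t⟩ : TangentBundle 𝓘(ℝ, E) M)) s ∧
    ∀ t ∈ s, covDerivAlong s γ V t = 0

variable (E)

/-- A geodesic defined on all of `ℝ`: a smooth curve whose velocity is parallel. -/
def IsGeodesic (γ : ℝ → M) : Prop :=
  ContMDiff 𝓘(ℝ, ℝ) 𝓘(ℝ, E) ∞ γ ∧ IsParallelOn (E := E) univ γ (velocity γ)

/-- The geodesic `γ` starts at time `0` at the point `p` with velocity `v`. -/
def IsGeodesicFrom (p : M) (v : TangentSpace 𝓘(ℝ, E) p) (γ : ℝ → M) : Prop :=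
  IsGeodesic E γ ∧
    (⟨γ 0, velocity γ 0⟩ : TangentBundle 𝓘(ℝ, E) M) = ⟨p, v⟩

variable (M) in
/-- Completeness: the geodesics are defined for all values of `t ∈ ℝ`. -/
def IsGeodesicallyComplete : Prop :=
  ∀ (p : M) (v : TangentSpace 𝓘(ℝ, E) p), ∃ γ : ℝ → M, IsGeodesicFrom E p v γ

open Classical in
/-- The exponential map `exp_p v = γ(1)`, where `γ` is the geodesic with `γ(0) = p` and
`γ'(0) = v`. -/
def expMap (p : M) (v : TangentSpace 𝓘(ℝ, E) p) : M :=
  if h : ∃ γ : ℝ → M, IsGeodesicFrom E p v γ then h.choose 1 else p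

/-- The restriction of `exp_p` to the open ball of radius `r` around the origin of the
tangent space (for the Riemannian norm) is a diffeomorphism onto an open subset of `M`. -/
def IsDiffeoOnBall (p : M) (r : ℝ) : Prop :=
  ∃ Φ : PartialDiffeomorph 𝓘(ℝ, TangentSpace 𝓘(ℝ, E) p) 𝓘(ℝ, E)
      (TangentSpace 𝓘(ℝ, E) p) M ∞,
    Φ.source = Metric.ball 0 r ∧ EqOn Φ (expMap E p) (Metric.ball 0 r)

/-- The injectivity radius at `p`, possibly infinite. -/
def injectivityRadius (p : M) : ℝ≥0∞ :=
  sSup {ρ : ℝ≥0∞ | ∃ r : ℝ, 0 < r ∧ IsDiffeoOnBall E p r ∧ ρ = ENNReal.ofReal r}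

/-- `γ`, restricted to `[0, 1]`, is a minimal geodesic segment joining `p` to `q`. -/
def IsMinimalGeodesic (p q : M) (γ : ℝ → M) : Prop :=
  IsGeodesic E γ ∧ γ 0 = p ∧ γ 1 = q ∧ pathELength 𝓘(ℝ, E) γ 0 1 = edist p q

variable {E}

/-- The tangent vector `w` at `q` is the value at time `1` of a parallel vector field with value
`u` at time `0` along a minimal geodesic segment from `p` to `q`. -/
def IsTransportOf (p q : M) (u : TangentSpace 𝓘(ℝ, E) p) (w : TangentSpace 𝓘(ℝ, E) q) : Prop :=
  ∃ (γ : ℝ → M) (V : ∀ t, TangentSpace 𝓘(ℝ, E) (γ t)),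
    IsMinimalGeodesic E p q γ ∧ IsParallelOn (Icc 0 1) γ V ∧
      (⟨γ 0, V 0⟩ : TangentBundle 𝓘(ℝ, E) M) = ⟨p, u⟩ ∧
      (⟨γ 1, V 1⟩ : TangentBundle 𝓘(ℝ, E) M) = ⟨q, w⟩

open Classical in
/-- The parallel transport `P_{pq} u` of `u` from `p` to `q` along the minimal geodesic
segment joining `p` to `q` (meaningful when there is exactly one such segment). -/
def parallelTransport (p q : M) (u : TangentSpace 𝓘(ℝ, E) p) : TangentSpace 𝓘(ℝ, E) q :=
  if h : ∃ w, IsTransportOf p q u w then h.choose else 0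

end RiemTransport

end

set_option maxSynthPendingDepth 3

/-! Choose `r > δ` such that `exp` is a diffeomorphism `Φ` on the `r`-ball of the tangent space at
`pbar`. This gives normal coordinates: rays through the origin are geodesics, and `Φ` is an isometry
at the origin.

The Gauss lemma (`gauss_lemma`) says that radial vectors keep their inner products with all vectors.
Hence a curve from the centre is at least as long as the norm of the coordinates it reaches, and a
curve shorter than the radius cannot leave the ball. So the `δ`-ball of `M` lies in the image of
`Φ`, the distance to the centre is the norm of the coordinates (`IsNormalChart.dist_eq_norm`), and
the only minimal geodesic to `Φ y` is the ray `t ↦ Φ (t • y)`.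

Along this ray a parallel field has components solving the linear equation `ξ' = -Γ(t • y; y, ξ)` on
`[0, 1]`, with coefficients jointly continuous in `(y, t)`. Linear theory gives existence,
uniqueness and continuity of `y ↦ ξ_y(1)`. The transported vector at `Φ y` is `dΦ_y (ξ_y(1))`, and
composing with `Φ.symm` gives continuity in the point of `M`.

The definitions compute covariant derivatives in a chart that moves with the curve. The
transformation law of the Christoffel symbols, through `IsLocalParam.covDerivAlong_eq_zero_iff`,
replaces it by any one parametrization, in particular by `Φ`. -/

noncomputable section
namespace RiemTransport

/-! ### Christoffel symbols of a field of bilinear forms on a normed space -/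

section Christoffel

variable {E F : Type*} [NormedAddCommGroup E] [NormedSpace ℝ E]
  [NormedAddCommGroup F] [NormedSpace ℝ F]

/-- The Christoffel symbols of a metric `G` on a normed space, as the linear map `b ↦ Γ(y; a, b)`. -/
def christoffelMap (G : E → E →L[ℝ] E →L[ℝ] ℝ) (y a : E) : E →L[ℝ] E :=
  (G y).inverse ∘L ((1 / 2 : ℝ) • (fderiv ℝ G y a + (fderiv ℝ G y).flip a
    - ((fderiv ℝ G y).flip a).flip))

/-- The Koszul formula: lowering the index removes the inverse metric. All later computations with
the symbols go through it. -/
theorem apply_christoffelMap {G : E → E →L[ℝ] E →L[ℝ] ℝ} {y : E} (hG : (G y).IsInvertible)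
    (a b w : E) :
    G y (christoffelMap G y a b) w =
      1 / 2 * (fderiv ℝ G y a b w + fderiv ℝ G y b a w - fderiv ℝ G y w a b) := by
  simp [christoffelMap, hG.self_apply_inverse]

theorem christoffelMap_smul (G : E → E →L[ℝ] E →L[ℝ] ℝ) (y a : E) (c : ℝ) :
    christoffelMap G y (c • a) = c • christoffelMap G y a := by
  ext b
  simp only [christoffelMap, ContinuousLinearMap.comp_apply, smul_apply,
    ← map_smul]
  congr 1
  ext w
  simp
  ring

theorem contDiffAt_christoffelMap [CompleteSpace E] {G : E → E →L[ℝ] E →L[ℝ] ℝ} {y a : E}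
    (hG : ContDiffAt ℝ ∞ G y) (hinv : (G y).IsInvertible) :
    ContDiffAt ℝ ∞ (fun p : E × E ↦ christoffelMap G p.1 p.2) (y, a) := by
  have h1 : ContDiffAt ℝ ∞ (fun p : E × E ↦ fderiv ℝ G p.1) (y, a) :=
    ContDiffAt.comp (y, a) (g := fderiv ℝ G) (f := Prod.fst)
      (hG.fderiv_right (m := ∞) (by simp)) contDiffAt_fst
  have h2 : ContDiffAt ℝ ∞ (fun p : E × E ↦ (G p.1).inverse) (y, a) :=
    ContDiffAt.comp (y, a) (g := ContinuousLinearMap.inverse) (f := fun p : E × E ↦ G p.1)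
      hinv.contDiffAt_map_inverse
      (ContDiffAt.comp (y, a) (g := G) (f := Prod.fst) hG contDiffAt_fst)
  have h3 : ContDiffAt ℝ ∞ (fun p : E × E ↦ (fderiv ℝ G p.1).flip) (y, a) :=
    (ContinuousLinearMap.flipₗᵢ ℝ E E (E →L[ℝ] ℝ)).contDiff.contDiffAt.comp (y, a) h1
  have h4 : ContDiffAt ℝ ∞ (fun p : E × E ↦ (fderiv ℝ G p.1).flip p.2) (y, a) :=
    h3.clm_apply contDiffAt_snd
  have h5 : ContDiffAt ℝ ∞ (fun p : E × E ↦ ((fderiv ℝ G p.1).flip p.2).flip) (y, a) :=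
    (ContinuousLinearMap.flipₗᵢ ℝ E E ℝ).contDiff.contDiffAt.comp (y, a) h4
  exact h2.clm_comp ((((h1.clm_apply contDiffAt_snd).add h4).sub h5).const_smul (1 / 2 : ℝ))

theorem fderiv_bilinearComp {G : E → E →L[ℝ] E →L[ℝ] ℝ} {ψ : F → E} {y : F}
    (hψ : ContDiffAt ℝ 2 ψ y) (hG : DifferentiableAt ℝ G (ψ y)) (a b w : F) :
    fderiv ℝ (fun z ↦ (G (ψ z)).bilinearComp (fderiv ℝ ψ z) (fderiv ℝ ψ z)) y a b w =
      fderiv ℝ G (ψ y) (fderiv ℝ ψ y a) (fderiv ℝ ψ y b) (fderiv ℝ ψ y w)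
      + G (ψ y) (fderiv ℝ (fderiv ℝ ψ) y a b) (fderiv ℝ ψ y w)
      + G (ψ y) (fderiv ℝ ψ y b) (fderiv ℝ (fderiv ℝ ψ) y a w) := by
  have hd : DifferentiableAt ℝ (fderiv ℝ ψ) y :=
    (hψ.fderiv_right (m := 1) (by norm_num)).differentiableAt one_ne_zero
  have hc : HasFDerivAt (fun z ↦ G (ψ z)) ((fderiv ℝ G (ψ y)).comp (fderiv ℝ ψ y)) y :=
    hG.hasFDerivAt.comp y (hψ.differentiableAt two_ne_zero).hasFDerivAt
  have hv (v : F) : HasFDerivAt (fun z ↦ fderiv ℝ ψ z v) ((fderiv ℝ (fderiv ℝ ψ) y).flip v) y := by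
    simpa using hd.hasFDerivAt.clm_apply (hasFDerivAt_const v y)
  have key := (hc.clm_apply (hv b)).clm_apply (hv w)
  have hdiff : DifferentiableAt ℝ
      (fun z ↦ (G (ψ z)).bilinearComp (fderiv ℝ ψ z) (fderiv ℝ ψ z)) y := by
    have : (fun z ↦ (G (ψ z)).bilinearComp (fderiv ℝ ψ z) (fderiv ℝ ψ z)) = fun z ↦
        ((ContinuousLinearMap.flipₗᵢ ℝ F F ℝ)
          (((ContinuousLinearMap.flipₗᵢ ℝ F E ℝ) ((G (ψ z)).comp (fderiv ℝ ψ z))).comp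
            (fderiv ℝ ψ z))) := rfl
    rw [this]
    exact (ContinuousLinearMap.flipₗᵢ ℝ F F ℝ).differentiableAt.comp y
      (((ContinuousLinearMap.flipₗᵢ ℝ F E ℝ).differentiableAt.comp y
        (hc.differentiableAt.clm_comp hd)).clm_comp hd)
  have key2 := (hdiff.hasFDerivAt.clm_apply (hasFDerivAt_const b y)).clm_apply
    (hasFDerivAt_const w y)
  have := congrArg (fun L ↦ L a) (key2.unique key)
  simp at this
  rw [this]
  ring

/-- The transformation law of the Christoffel symbols under a change of coordinates. -/
theorem fderiv_christoffelMap_pullback {G : E → E →L[ℝ] E →L[ℝ] ℝ}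
    {G' : F → F →L[ℝ] F →L[ℝ] ℝ} {ψ : F → E} {y : F}
    (hψ : ContDiffAt ℝ 2 ψ y) (hψi : (fderiv ℝ ψ y).IsInvertible)
    (hG : DifferentiableAt ℝ G (ψ y)) (hsymm : ∀ a b, G (ψ y) a b = G (ψ y) b a)
    (hGi : (G (ψ y)).IsInvertible) (hGi' : (G' y).IsInvertible)
    (hG' : G' =ᶠ[𝓝 y] fun z ↦ (G (ψ z)).bilinearComp (fderiv ℝ ψ z) (fderiv ℝ ψ z)) (a b : F) :
    fderiv ℝ ψ y (christoffelMap G' y a b) =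
      christoffelMap G (ψ y) (fderiv ℝ ψ y a) (fderiv ℝ ψ y b)
        + fderiv ℝ (fderiv ℝ ψ) y a b := by
  -- As the metric is nondegenerate and `dψ` is onto, both sides may be tested against vectors `dψ
  -- w`. The Koszul formula applies to each, and by symmetry of the second derivative and of `G` all
  -- second-derivative terms cancel but one.
  apply hGi.injective
  ext w'
  obtain ⟨w, rfl⟩ := hψi.surjective w'
  have h0 : G (ψ y) (fderiv ℝ ψ y (christoffelMap G' y a b)) (fderiv ℝ ψ y w) =
      G' y (christoffelMap G' y a b) w := by
    rw [hG'.eq_of_nhds]; rfl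
  have hs : ∀ v w, fderiv ℝ (fderiv ℝ ψ) y v w = fderiv ℝ (fderiv ℝ ψ) y w v :=
    fun v w ↦ hψ.isSymmSndFDerivAt (by simp) v w
  rw [h0, apply_christoffelMap hGi', hG'.fderiv_eq, fderiv_bilinearComp hψ hG,
    fderiv_bilinearComp hψ hG, fderiv_bilinearComp hψ hG, map_add, add_apply,
    apply_christoffelMap hGi, hs b a, hs w a, hs w b,
    hsymm (fderiv ℝ ψ y b) (fderiv ℝ (fderiv ℝ ψ) y a w)]
  ring

end Christoffel

/-- Brings the symbols used in the definition of `covDerivAlong` under the general results above. -/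
theorem christoffel_eq {E : Type*} [NormedAddCommGroup E] [NormedSpace ℝ E]
    {M : Type*} [MetricSpace M] [ChartedSpace E M]
    [RiemannianBundle (fun x : M ↦ TangentSpace 𝓘(ℝ, E) x)] (x₀ : M) (y a b : E) :
    christoffel x₀ y a b = christoffelMap (metricInChart x₀) y a b := rfl

/-! ### Local parametrizations and the parallel transport equation in them -/

section LocalParam

variable {E : Type*} [NormedAddCommGroup E] [NormedSpace ℝ E]
  {F : Type*} [NormedAddCommGroup F] [NormedSpace ℝ F]
  {F' : Type*} [NormedAddCommGroup F'] [NormedSpace ℝ F']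
  {M : Type*} [MetricSpace M] [ChartedSpace E M]

variable (E) in
/-- `φ` is smooth on the open set `U` of a normed space, with invertible differential. -/
structure IsLocalParam (φ : F → M) (U : Set F) : Prop where
  isOpen : IsOpen U
  contMDiffOn : ContMDiffOn 𝓘(ℝ, F) 𝓘(ℝ, E) ∞ φ U
  isInvertible : ∀ y ∈ U, (mfderiv 𝓘(ℝ, F) 𝓘(ℝ, E) φ y).IsInvertible

theorem IsLocalParam.contMDiffAt {φ : F → M} {U : Set F} (hφ : IsLocalParam E φ U) {y : F}
    (hy : y ∈ U) : ContMDiffAt 𝓘(ℝ, F) 𝓘(ℝ, E) ∞ φ y :=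
  hφ.contMDiffOn.contMDiffAt (hφ.isOpen.mem_nhds hy)

theorem IsLocalParam.mdifferentiableAt {φ : F → M} {U : Set F} (hφ : IsLocalParam E φ U) {y : F}
    (hy : y ∈ U) : MDifferentiableAt 𝓘(ℝ, F) 𝓘(ℝ, E) φ y :=
  (hφ.contMDiffAt hy).mdifferentiableAt (by simp)

theorem isLocalParam_extChartAt_symm [IsManifold 𝓘(ℝ, E) ∞ M] (x₀ : M) :
    IsLocalParam E (extChartAt 𝓘(ℝ, E) x₀).symm (extChartAt 𝓘(ℝ, E) x₀).target where
  isOpen := isOpen_extChartAt_target x₀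
  contMDiffOn := contMDiffOn_extChartAt_symm x₀
  isInvertible y hy := by
    have h := isInvertible_mfderivWithin_extChartAt_symm (I := 𝓘(ℝ, E)) (M := M) hy
    simpa [mfderivWithin_univ] using h

/-- Writing the source as pairs in `F × F` lets components depending on parameters be pushed into
the tangent bundle of `M`; the final continuity statement rests on this. -/
theorem contMDiffOn_tangentMap {φ : F → M} {U : Set F} [IsManifold 𝓘(ℝ, E) ∞ M]
    (hU : IsOpen U) (hφ : ContMDiffOn 𝓘(ℝ, F) 𝓘(ℝ, E) ∞ φ U) :
    ContMDiffOn (𝓘(ℝ, F).prod 𝓘(ℝ, F)) 𝓘(ℝ, E).tangent ∞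
      (fun p : F × F ↦ tangentMap 𝓘(ℝ, F) 𝓘(ℝ, E) φ ⟨p.1, p.2⟩) (U ×ˢ univ) := by
  have h1 : ContMDiffOn 𝓘(ℝ, F).tangent 𝓘(ℝ, E).tangent ∞
      (tangentMapWithin 𝓘(ℝ, F) 𝓘(ℝ, E) φ U) (π F (TangentSpace 𝓘(ℝ, F)) ⁻¹' U) :=
    hφ.contMDiffOn_tangentMapWithin (by simp) hU.uniqueMDiffOn
  have h2 : ContMDiff (𝓘(ℝ, F).prod 𝓘(ℝ, F)) 𝓘(ℝ, F).tangent ∞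
      (fun p : F × F ↦ (⟨p.1, p.2⟩ : TangentBundle 𝓘(ℝ, F) F)) := by
    have h := contMDiff_tangentBundleModelSpaceHomeomorph_symm (I := 𝓘(ℝ, F)) (n := ∞)
    convert! h
    exact chartedSpaceSelf_prod
  have h3 := h1.comp (h2.contMDiffOn (s := U ×ˢ univ)) (fun p hp ↦ hp.1)
  refine h3.congr fun p hp ↦ ?_
  have : mfderivWithin 𝓘(ℝ, F) 𝓘(ℝ, E) φ U p.1 = mfderiv 𝓘(ℝ, F) 𝓘(ℝ, E) φ p.1 :=
    mfderivWithin_of_isOpen hU hp.1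
  simp only [tangentMap, tangentMapWithin, Function.comp_apply, this]

/-- The tangent vector to a curve read in a parametrization. -/
theorem mk_velocity_eq {φ : F → M} {γ : ℝ → M} {x : ℝ → F} {x' : F} {t : ℝ}
    (hφ : MDifferentiableAt 𝓘(ℝ, F) 𝓘(ℝ, E) φ (x t)) (hx : HasDerivAt x x' t)
    (hγ : γ =ᶠ[𝓝 t] φ ∘ x) :
    (⟨γ t, velocity γ t⟩ : TangentBundle 𝓘(ℝ, E) M) =
      tangentMap 𝓘(ℝ, F) 𝓘(ℝ, E) φ ⟨x t, x'⟩ := by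
  have h : HasMFDerivAt 𝓘(ℝ, ℝ) 𝓘(ℝ, E) (φ ∘ x) t
      ((mfderiv 𝓘(ℝ, F) 𝓘(ℝ, E) φ (x t)).comp (ContinuousLinearMap.toSpanSingleton ℝ x')) :=
    hφ.hasMFDerivAt.comp t hx.hasFDerivAt.hasMFDerivAt
  have h2 := h.congr_of_eventuallyEq hγ
  have h3 : velocity γ t = mfderiv 𝓘(ℝ, F) 𝓘(ℝ, E) φ (x t) x' := by
    have := congrArg (fun L : ℝ →L[ℝ] E ↦ L (1 : ℝ)) h2.mfderiv
    refine this.trans ?_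
    change mfderiv 𝓘(ℝ, F) 𝓘(ℝ, E) φ (x t) ((1 : ℝ) • x') = _
    rw [one_smul]
  unfold tangentMap
  rw [h3, hγ.eq_of_nhds]
  rfl

variable [RiemannianBundle (fun x : M ↦ TangentSpace 𝓘(ℝ, E) x)]

/-- The Riemannian metric on the tangent space at `x`, identified with `E`. -/
def metricAt (x : M) (a b : E) : ℝ := inner ℝ (E := TangentSpace 𝓘(ℝ, E) x) a b

/-- The metric tensor in the local parametrization `φ`. -/
def pullbackMetric (φ : F → M) (y : F) : F →L[ℝ] F →L[ℝ] ℝ :=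
  (innerSL ℝ (E := TangentSpace 𝓘(ℝ, E) (φ y))).bilinearComp
    (mfderiv 𝓘(ℝ, F) 𝓘(ℝ, E) φ y) (mfderiv 𝓘(ℝ, F) 𝓘(ℝ, E) φ y)

theorem pullbackMetric_apply (φ : F → M) (y a b : F) :
    pullbackMetric (E := E) φ y a b = metricAt (E := E) (φ y) (mfderiv 𝓘(ℝ, F) 𝓘(ℝ, E) φ y a)
      (mfderiv 𝓘(ℝ, F) 𝓘(ℝ, E) φ y b) := rfl

theorem pullbackMetric_apply_self (φ : F → M) (y a : F) :
    pullbackMetric (E := E) φ y a a = ‖mfderiv 𝓘(ℝ, F) 𝓘(ℝ, E) φ y a‖ ^ 2 :=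
  real_inner_self_eq_norm_sq (F := TangentSpace 𝓘(ℝ, E) (φ y)) _

theorem pullbackMetric_comm (φ : F → M) (y a b : F) :
    pullbackMetric (E := E) φ y a b = pullbackMetric (E := E) φ y b a :=
  real_inner_comm (F := TangentSpace 𝓘(ℝ, E) (φ y)) _ _

theorem pullbackMetric_congr {φ φ' : F → M} {y : F} (h : φ =ᶠ[𝓝 y] φ') :
    pullbackMetric (E := E) φ y = pullbackMetric (E := E) φ' y := by
  ext a b
  have h1 : ∀ c : F, (mfderiv 𝓘(ℝ, F) 𝓘(ℝ, E) φ y c : E) = mfderiv 𝓘(ℝ, F) 𝓘(ℝ, E) φ' y c :=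
    fun c ↦ congrArg (fun L : F →L[ℝ] E ↦ L c) h.mfderiv_eq
  rw [pullbackMetric_apply, pullbackMetric_apply, h1 a, h1 b, h.eq_of_nhds]

theorem pullbackMetric_comp {φ : F → M} {ψ : F' → F} {z : F'}
    (hφ : MDifferentiableAt 𝓘(ℝ, F) 𝓘(ℝ, E) φ (ψ z)) (hψ : DifferentiableAt ℝ ψ z) :
    pullbackMetric (E := E) (φ ∘ ψ) z =
      (pullbackMetric (E := E) φ (ψ z)).bilinearComp (fderiv ℝ ψ z) (fderiv ℝ ψ z) := by
  ext a b
  have h1 : ∀ c : F', (mfderiv 𝓘(ℝ, F') 𝓘(ℝ, E) (φ ∘ ψ) z c : E) =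
      mfderiv 𝓘(ℝ, F) 𝓘(ℝ, E) φ (ψ z) (fderiv ℝ ψ z c) := fun c ↦ by
    have := mfderiv_comp z hφ hψ.mdifferentiableAt
    rw [mfderiv_eq_fderiv] at this
    exact congrArg (fun L : F' →L[ℝ] E ↦ L c) this
  rw [pullbackMetric_apply, h1 a, h1 b]
  rfl

/-- Positive definiteness gives injectivity, and `F` has the same dimension as its dual. -/
theorem isInvertible_pullbackMetric [FiniteDimensional ℝ F] {φ : F → M} {y : F}
    (h : (mfderiv 𝓘(ℝ, F) 𝓘(ℝ, E) φ y).IsInvertible) :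
    (pullbackMetric (E := E) φ y).IsInvertible := by
  have hinj : Function.Injective (pullbackMetric (E := E) φ y) := by
    rw [injective_iff_map_eq_zero]
    intro a ha
    have h1 : pullbackMetric (E := E) φ y a a = 0 := by rw [ha]; rfl
    rw [pullbackMetric_apply_self] at h1
    exact h.injective ((norm_eq_zero.1 (by simpa using h1)).trans (map_zero _).symm)
  have hdim : Module.finrank ℝ F = Module.finrank ℝ (F →L[ℝ] ℝ) := by
    rw [← (LinearMap.toContinuousLinearMap (E := F) (F' := ℝ) (𝕜 := ℝ)).finrank_eq]
    exact (Subspace.dual_finrank_eq).symm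
  let e := LinearEquiv.ofInjectiveOfFinrankEq
    (pullbackMetric (E := E) φ y : F →ₗ[ℝ] F →L[ℝ] ℝ) hinj hdim
  exact ⟨e.toContinuousLinearEquiv, by ext; rfl⟩

variable [IsManifold 𝓘(ℝ, E) ∞ M]

/-- The change of coordinates from a local parametrization to a chart. -/
theorem IsLocalParam.transition {φ : F → M} {U : Set F} (hφ : IsLocalParam E φ U) {y : F}
    (hy : y ∈ U) {x₀ : M} (hx₀ : φ y ∈ (extChartAt 𝓘(ℝ, E) x₀).source) :
    ContDiffAt ℝ ∞ (extChartAt 𝓘(ℝ, E) x₀ ∘ φ) y ∧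
    (∀ᶠ z in 𝓝 y, ∀ a, fderiv ℝ (extChartAt 𝓘(ℝ, E) x₀ ∘ φ) z a =
      coordOf x₀ (φ z) (mfderiv 𝓘(ℝ, F) 𝓘(ℝ, E) φ z a)) ∧
    (fderiv ℝ (extChartAt 𝓘(ℝ, E) x₀ ∘ φ) y).IsInvertible ∧
    pullbackMetric (E := E) φ =ᶠ[𝓝 y] fun z ↦
      (metricInChart x₀ ((extChartAt 𝓘(ℝ, E) x₀ ∘ φ) z)).bilinearComp
        (fderiv ℝ (extChartAt 𝓘(ℝ, E) x₀ ∘ φ) z) (fderiv ℝ (extChartAt 𝓘(ℝ, E) x₀ ∘ φ) z) := by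
  have hU' : ∀ᶠ z in 𝓝 y, z ∈ U ∧ φ z ∈ (extChartAt 𝓘(ℝ, E) x₀).source := by
    filter_upwards [hφ.isOpen.mem_nhds hy, (hφ.contMDiffAt hy).continuousAt.preimage_mem_nhds
      ((isOpen_extChartAt_source x₀).mem_nhds hx₀)] with z h1 h2 using ⟨h1, h2⟩
  have hch {p : M} (hp : p ∈ (extChartAt 𝓘(ℝ, E) x₀).source) :
      ContMDiffAt 𝓘(ℝ, E) 𝓘(ℝ, E) ∞ (extChartAt 𝓘(ℝ, E) x₀) p :=
    contMDiffAt_extChartAt' (by simpa using hp)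
  have hcd {z : F} (hz : z ∈ U ∧ φ z ∈ (extChartAt 𝓘(ℝ, E) x₀).source) :
      ContDiffAt ℝ ∞ (extChartAt 𝓘(ℝ, E) x₀ ∘ φ) z :=
    ((hch hz.2).comp z (hφ.contMDiffAt hz.1)).contDiffAt
  have hmf {z : F} (hz : z ∈ U ∧ φ z ∈ (extChartAt 𝓘(ℝ, E) x₀).source) :
      (fderiv ℝ (extChartAt 𝓘(ℝ, E) x₀ ∘ φ) z : F →L[ℝ] E) =
        (mfderiv 𝓘(ℝ, E) 𝓘(ℝ, E) (extChartAt 𝓘(ℝ, E) x₀) (φ z)).comp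
          (mfderiv 𝓘(ℝ, F) 𝓘(ℝ, E) φ z) := by
    rw [← mfderiv_comp z ((hch hz.2).mdifferentiableAt (by simp)) (hφ.mdifferentiableAt hz.1),
      mfderiv_eq_fderiv]
  refine ⟨hcd ⟨hy, hx₀⟩, ?_, ?_, ?_⟩
  · filter_upwards [hU'] with z hz a
    exact congrArg (fun L : F →L[ℝ] E ↦ L a) (hmf hz)
  · rw [hmf ⟨hy, hx₀⟩]
    exact (isInvertible_mfderiv_extChartAt hx₀).comp (hφ.isInvertible y hy)
  · have hU2 := hU'.eventually_nhds
    filter_upwards [hU2] with z hz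
    have hz0 := hz.self_of_nhds
    have hcongr : φ =ᶠ[𝓝 z] (extChartAt 𝓘(ℝ, E) x₀).symm ∘ (extChartAt 𝓘(ℝ, E) x₀ ∘ φ) := by
      filter_upwards [hz] with w hw
      exact ((extChartAt 𝓘(ℝ, E) x₀).left_inv hw.2).symm
    rw [pullbackMetric_congr hcongr]
    exact pullbackMetric_comp ((isLocalParam_extChartAt_symm x₀).mdifferentiableAt
      ((extChartAt 𝓘(ℝ, E) x₀).map_source hz0.2)) ((hcd hz0).differentiableAt (by simp))

variable [IsContMDiffRiemannianBundle 𝓘(ℝ, E) ∞ E (fun x : M ↦ TangentSpace 𝓘(ℝ, E) x)]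

theorem IsLocalParam.contDiffOn_pullbackMetric [FiniteDimensional ℝ F] {φ : F → M} {U : Set F}
    (hφ : IsLocalParam E φ U) : ContDiffOn ℝ ∞ (pullbackMetric (E := E) φ) U := by
  have h (a : F) : ContMDiffOn 𝓘(ℝ, F) 𝓘(ℝ, E).tangent ∞
      (fun y ↦ (⟨φ y, mfderiv 𝓘(ℝ, F) 𝓘(ℝ, E) φ y a⟩ : TangentBundle 𝓘(ℝ, E) M)) U :=
    (contMDiffOn_tangentMap hφ.isOpen hφ.contMDiffOn).comp
      (t := U ×ˢ univ) (f := fun y : F ↦ (y, a)) (contMDiffOn_id.prodMk contMDiffOn_const)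
      (fun y hy ↦ ⟨hy, mem_univ _⟩)
  rw [contDiffOn_clm_apply]
  intro a
  rw [contDiffOn_clm_apply]
  intro b
  rw [← contMDiffOn_iff_contDiffOn]
  exact ContMDiffOn.inner_bundle (F := E) (E := fun x : M ↦ TangentSpace 𝓘(ℝ, E) x) (b := φ)
    (v := fun y ↦ mfderiv 𝓘(ℝ, F) 𝓘(ℝ, E) φ y a) (w := fun y ↦ mfderiv 𝓘(ℝ, F) 𝓘(ℝ, E) φ y b)
    (h a) (h b)

/-- A vector field along a curve is parallel if and only if its components in a local
parametrization satisfy the equation `ξ' + Γ(x; x', ξ) = 0`. -/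
theorem IsLocalParam.covDerivAlong_eq_zero_iff [FiniteDimensional ℝ E] [FiniteDimensional ℝ F]
    {φ : F → M} {U : Set F} (hφ : IsLocalParam E φ U) {s : Set ℝ} {t : ℝ}
    (hs : UniqueDiffWithinAt ℝ s t) (ht : t ∈ s) {γ : ℝ → M}
    {V : ∀ t, TangentSpace 𝓘(ℝ, E) (γ t)} {x ξ : ℝ → F} {x' ξ' : F} (hxU : x t ∈ U)
    (hx : HasDerivWithinAt x x' s t) (hξ : HasDerivWithinAt ξ ξ' s t)
    (hV : ∀ᶠ r in 𝓝[s] t, (⟨γ r, V r⟩ : TangentBundle 𝓘(ℝ, E) M) =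
      tangentMap 𝓘(ℝ, F) 𝓘(ℝ, E) φ ⟨x r, ξ r⟩) :
    covDerivAlong s γ V t = 0 ↔
      ξ' + christoffelMap (pullbackMetric (E := E) φ) (x t) x' (ξ t) = 0 := by
  have hVt := hV.self_of_nhdsWithin ht
  have hγt : γ t = φ (x t) := congrArg TotalSpace.proj hVt
  obtain ⟨h1, h2, h3, h4⟩ := hφ.transition hxU (x₀ := γ t)
    (by rw [← hγt]; exact mem_extChartAt_source (γ t))
  set ψ : F → E := extChartAt 𝓘(ℝ, E) (γ t) ∘ φ with hψ
  have hproj : ∀ᶠ r in 𝓝[s] t, extChartAt 𝓘(ℝ, E) (γ t) (γ r) = ψ (x r) := by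
    filter_upwards [hV] with r hr
    exact congrArg (extChartAt 𝓘(ℝ, E) (γ t)) (congrArg TotalSpace.proj hr)
  have hcoord : ∀ᶠ r in 𝓝[s] t, coordOf (γ t) (γ r) (V r) = fderiv ℝ ψ (x r) (ξ r) := by
    filter_upwards [hV, hx.continuousWithinAt.eventually h2] with r hr hr2
    rw [hr2]
    exact congrArg (fun p : TangentBundle 𝓘(ℝ, E) M ↦ (coordOf (γ t) p.1 p.2 : E)) hr
  have d1 : derivWithin (fun r ↦ extChartAt 𝓘(ℝ, E) (γ t) (γ r)) s t = fderiv ℝ ψ (x t) x' :=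
    (((h1.differentiableAt (by simp)).hasFDerivAt.comp_hasDerivWithinAt t hx).congr_of_eventuallyEq
      hproj (hproj.self_of_nhdsWithin ht)).derivWithin hs
  -- The product rule leaves a second-derivative term of `ψ`, which is the inhomogeneous term of the
  -- transformation law used in `key`.
  have d2 : derivWithin (F := E) (fun r ↦ coordOf (γ t) (γ r) (V r)) s t =
      fderiv ℝ (fderiv ℝ ψ) (x t) x' (ξ t) + fderiv ℝ ψ (x t) ξ' := by
    have hd : DifferentiableAt ℝ (fderiv ℝ ψ) (x t) :=
      (h1.fderiv_right (m := 1) (by norm_cast)).differentiableAt one_ne_zero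
    exact ((((hd.hasFDerivAt.comp_hasDerivWithinAt t hx).clm_apply hξ)).congr_of_eventuallyEq
      hcoord (hcoord.self_of_nhdsWithin ht)).derivWithin hs
  have hmem : ψ (x t) ∈ (extChartAt 𝓘(ℝ, E) (γ t)).target := by
    simp only [hψ, Function.comp_apply, ← hγt]
    exact mem_extChartAt_target (γ t)
  have hparam := isLocalParam_extChartAt_symm (E := E) (γ t)
  have hG : DifferentiableAt ℝ (metricInChart (E := E) (γ t)) (ψ (x t)) :=
    (hparam.contDiffOn_pullbackMetric.contDiffAt
      (hparam.isOpen.mem_nhds hmem)).differentiableAt (by simp)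
  have key := fderiv_christoffelMap_pullback (h1.of_le (by norm_cast)) h3 hG
    (pullbackMetric_comm _ _) (isInvertible_pullbackMetric (hparam.isInvertible _ hmem))
    (isInvertible_pullbackMetric (hφ.isInvertible _ hxU)) h4 x' (ξ t)
  have hc : covDerivAlong s γ V t =
      fderiv ℝ ψ (x t) (ξ' + christoffelMap (pullbackMetric (E := E) φ) (x t) x' (ξ t)) := by
    unfold covDerivAlong
    rw [d1, d2, hproj.self_of_nhdsWithin ht, hcoord.self_of_nhdsWithin ht, christoffel_eq,
      map_add, key]
    abel
  rw [hc]
  exact (map_eq_zero_iff _ h3.injective)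

end LocalParam

/-! ### Linear differential equations on `[0, 1]` and local uniqueness in second order -/

section ODE

variable {E : Type*} [NormedAddCommGroup E] [NormedSpace ℝ E]

theorem exists_norm_le_of_continuousOn_Icc {E : Type*} [NormedAddCommGroup E] {A : ℝ → E} (hA : ContinuousOn A (Icc 0 1)) :
    ∃ C : ℝ≥0, ∀ t ∈ Icc (0 : ℝ) 1, ‖A t‖ ≤ C := by
  obtain ⟨C, hC⟩ := isCompact_Icc.exists_bound_of_continuousOn hA
  exact ⟨C.toNNReal, fun t ht ↦ (hC t ht).trans (Real.le_coe_toNNReal C)⟩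

/-- Existence of solutions of linear differential equations on the whole interval. -/
theorem exists_solution_linear_ode [FiniteDimensional ℝ E] {A : ℝ → E →L[ℝ] E}
    (hA : ContinuousOn A (Icc 0 1)) (u : E) :
    ∃ ξ : ℝ → E, ξ 0 = u ∧
      ∀ t ∈ Icc (0 : ℝ) 1, HasDerivWithinAt ξ (A t (ξ t)) (Icc 0 1) t := by
  have : CompleteSpace E := FiniteDimensional.complete ℝ E
  obtain ⟨C, hC⟩ := exists_norm_le_of_continuousOn_Icc hA
  -- `R` exceeds the Grönwall bound `‖u‖ e^C` for solutions; the `+ 1` keeps it positive. The field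
  -- is cut off to vanish outside radius `R + 1` and is unchanged within `R`, so it is bounded and
  -- Picard–Lindelöf covers the whole interval.
  set R : ℝ := (‖u‖ + 1) * Real.exp C with hR
  have hRpos : 0 < R := by positivity
  let b : ContDiffBump (0 : E) := ⟨R, R + 1, hRpos, by linarith⟩
  have hb1 (x : E) : ‖b x • x‖ ≤ ‖x‖ := by
    rw [norm_smul, Real.norm_of_nonneg b.nonneg]
    exact mul_le_of_le_one_left (norm_nonneg x) b.le_one
  have hb2 (x : E) : ‖b x • x‖ ≤ R + 1 := by
    by_cases hx : ‖x‖ < R + 1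
    · exact (hb1 x).trans hx.le
    · rw [b.zero_of_le_dist (by simpa [b] using hx)]
      simp only [zero_smul, norm_zero]
      positivity
  have hb3 {x : E} (hx : ‖x‖ ≤ R) : b x • x = x := by
    rw [b.one_of_mem_closedBall (by simpa [b] using hx), one_smul]
  obtain ⟨K, hK⟩ : ∃ K : ℝ≥0, LipschitzWith K (fun x : E ↦ b x • x) := by
    have h1 : ContDiff ℝ 1 (fun x : E ↦ b x • x) := b.contDiff.smul contDiff_id
    exact ContDiff.lipschitzWith_of_hasCompactSupport b.hasCompactSupport.smul_right h1 one_ne_zero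
  set L : ℝ≥0 := C * (R + 1).toNNReal with hL
  have hLR : (L : ℝ) = C * (R + 1) := by
    rw [hL, NNReal.coe_mul, Real.coe_toNNReal _ (by positivity)]
  have hPL : IsPicardLindelof (fun t x ↦ A t (b x • x)) (⟨0, by simp⟩ : Icc (0 : ℝ) 1) u L 0 L
      (C * K) := by
    refine ⟨fun t ht ↦ ?_, fun x _ ↦ ?_, fun t ht x _ ↦ ?_, ?_⟩
    · have h1 : LipschitzWith (C * K) (fun x : E ↦ A t (b x • x)) :=
        ((A t).lipschitz.weaken (hC t ht)).comp hK
      exact h1.lipschitzOnWith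
    · exact hA.clm_apply continuousOn_const
    · rw [hLR]
      exact ((A t).le_opNorm _).trans (mul_le_mul (hC t ht) (hb2 x) (norm_nonneg _) C.2)
    · simp
  obtain ⟨ξ, h0, hξ⟩ := hPL.exists_eq_forall_mem_Icc_hasDerivWithinAt₀
  refine ⟨ξ, h0, fun t ht ↦ ?_⟩
  -- The truncated field still has norm at most `C * ‖x‖`, so its solution never leaves the ball
  -- where the cut-off equals one and it solves the original equation.
  have hbound := norm_le_gronwallBound_of_norm_deriv_right_le (f := ξ) (δ := ‖u‖) (K := C)
    (ε := 0) (fun t ht ↦ (hξ t ht).continuousWithinAt)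
    (fun t ht ↦ (hξ t (Ico_subset_Icc_self ht)).mono_of_mem_nhdsWithin
      (Icc_mem_nhdsGE_of_mem ht)) (by rw [h0])
    (fun t ht ↦ by
      rw [add_zero]
      exact ((A t).le_opNorm _).trans (mul_le_mul (hC t (Ico_subset_Icc_self ht)) (hb1 _)
        (norm_nonneg _) C.2))
  have hξR : ‖ξ t‖ ≤ R := by
    refine (hbound t ht).trans ?_
    rw [gronwallBound_ε0, sub_zero, hR]
    have : (C : ℝ) * t ≤ C := mul_le_of_le_one_right C.2 ht.2
    gcongr
    linarith
  simpa only [hb3 hξR] using hξ t ht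

/-- Uniqueness of solutions of linear differential equations. -/
theorem eqOn_of_linear_ode {A : ℝ → E →L[ℝ] E} (hA : ContinuousOn A (Icc 0 1)) {ξ η : ℝ → E}
    (hξ : ∀ t ∈ Icc (0 : ℝ) 1, HasDerivWithinAt ξ (A t (ξ t)) (Icc 0 1) t)
    (hη : ∀ t ∈ Icc (0 : ℝ) 1, HasDerivWithinAt η (A t (η t)) (Icc 0 1) t)
    (h0 : ξ 0 = η 0) : EqOn ξ η (Icc 0 1) := by
  obtain ⟨C, hC⟩ := exists_norm_le_of_continuousOn_Icc hA
  exact ODE_solution_unique_of_mem_Icc_right (v := fun t x ↦ A t x) (s := fun _ ↦ univ) (K := C)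
    (fun t ht ↦ lipschitzOnWith_univ.2
      ((A t).lipschitz.weaken (hC t (Ico_subset_Icc_self ht))))
    (fun t ht ↦ (hξ t ht).continuousWithinAt)
    (fun t ht ↦ (hξ t (Ico_subset_Icc_self ht)).mono_of_mem_nhdsWithin
      (Icc_mem_nhdsGE_of_mem ht)) (fun _ _ ↦ mem_univ _)
    (fun t ht ↦ (hη t ht).continuousWithinAt)
    (fun t ht ↦ (hη t (Ico_subset_Icc_self ht)).mono_of_mem_nhdsWithin
      (Icc_mem_nhdsGE_of_mem ht)) (fun _ _ ↦ mem_univ _) h0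

/-- Continuous dependence on parameters of the solutions of linear differential equations. -/
theorem continuousOn_linear_ode {X : Type*} [TopologicalSpace X] {S : Set X}
    {A : X → ℝ → E →L[ℝ] E} (hA : ContinuousOn (Function.uncurry A) (S ×ˢ Icc 0 1))
    {ξ : X → ℝ → E} {u : E} (h0 : ∀ x ∈ S, ξ x 0 = u)
    (hξ : ∀ x ∈ S, ∀ t ∈ Icc (0 : ℝ) 1, HasDerivWithinAt (ξ x) (A x t (ξ x t)) (Icc 0 1) t) :
    ContinuousOn (fun x ↦ ξ x 1) S := by
  intro x₀ hx₀
  have hA0 : ContinuousOn (A x₀) (Icc 0 1) :=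
    hA.comp (f := fun t : ℝ ↦ (x₀, t)) (by fun_prop) (fun t ht ↦ ⟨hx₀, ht⟩)
  obtain ⟨C, hC⟩ := exists_norm_le_of_continuousOn_Icc hA0
  obtain ⟨B, hB⟩ := exists_norm_le_of_continuousOn_Icc (A := ξ x₀)
    (fun t ht ↦ (hξ x₀ hx₀ t ht).continuousWithinAt)
  have hlim : Filter.Tendsto (fun ε : ℝ ↦ gronwallBound 0 (C + 1) (ε * B + 0) (1 - 0))
      (𝓝[>] 0) (𝓝 0) := by
    have : Continuous (fun ε : ℝ ↦ gronwallBound 0 (C + 1) (ε * B + 0) (1 - 0)) :=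
      (gronwallBound_continuous_ε _ _ _).comp (by fun_prop)
    have h := this.tendsto 0
    simp only [zero_mul, add_zero, gronwallBound_ε0, zero_mul] at h
    simpa using h.mono_left nhdsWithin_le_nhds
  rw [ContinuousWithinAt, Metric.tendsto_nhds]
  intro e he
  -- The condition `ε < 1` makes `C + 1` a Lipschitz constant for every nearby parameter.
  obtain ⟨ε, hε, hε0, hε1⟩ := ((hlim.eventually (gt_mem_nhds he)).and
    (Ioo_mem_nhdsGT (zero_lt_one (α := ℝ)))).exists
  -- Compactness of `[0, 1]` makes the closeness of coefficients uniform in `t`.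
  obtain ⟨v, hv, hv'⟩ := isCompact_Icc.mem_uniformity_of_prod hA hx₀ (Metric.dist_mem_uniformity hε0)
  filter_upwards [hv, self_mem_nhdsWithin] with x hxv hxS
  refine lt_of_le_of_lt ?_ hε
  have hclose (t : ℝ) (ht : t ∈ Icc (0 : ℝ) 1) : ‖A x t - A x₀ t‖ ≤ ε := by
    rw [← dist_eq_norm]
    exact (hv' x hxv t ht).le
  rw [dist_comm]
  -- The solution for `x₀` is viewed as an approximate solution of the equation for `x`, with error
  -- at most `ε * B`.
  refine dist_le_of_approx_trajectories_ODE_of_mem (v := fun t y ↦ A x t y) (s := fun _ ↦ univ)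
    (K := C + 1) (f := ξ x₀) (g := ξ x) (f' := fun t ↦ A x₀ t (ξ x₀ t))
    (g' := fun t ↦ A x t (ξ x t)) (a := 0) (b := 1) (εf := ε * B) (εg := 0)
    (fun t ht ↦ lipschitzOnWith_univ.2 ((A x t).lipschitz.weaken ?_))
    (fun t ht ↦ (hξ x₀ hx₀ t ht).continuousWithinAt)
    (fun t ht ↦ (hξ x₀ hx₀ t (Ico_subset_Icc_self ht)).mono_of_mem_nhdsWithin
      (Icc_mem_nhdsGE_of_mem ht)) (fun t ht ↦ ?_) (fun _ _ ↦ mem_univ _)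
    (fun t ht ↦ (hξ x hxS t ht).continuousWithinAt)
    (fun t ht ↦ (hξ x hxS t (Ico_subset_Icc_self ht)).mono_of_mem_nhdsWithin
      (Icc_mem_nhdsGE_of_mem ht)) (fun t ht ↦ by simp) (fun _ _ ↦ mem_univ _)
    (by rw [h0 x hxS, h0 x₀ hx₀, dist_self]) 1 (by simp)
  · have h1 := hclose t (Ico_subset_Icc_self ht)
    have h2 := hC t (Ico_subset_Icc_self ht)
    have h3 : ‖A x t‖ ≤ ‖A x₀ t‖ + ‖A x t - A x₀ t‖ := by
      simpa using norm_add_le (A x₀ t) (A x t - A x₀ t)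
    rw [← NNReal.coe_le_coe]
    push_cast
    linarith
  · rw [dist_comm, dist_eq_norm, ← sub_apply]
    exact ((A x t - A x₀ t).le_opNorm _).trans
      (mul_le_mul (hclose t (Ico_subset_Icc_self ht)) (hB t (Ico_subset_Icc_self ht))
        (norm_nonneg _) hε0.le)

/-- Local uniqueness for second order differential equations. -/
theorem eventuallyEq_of_second_order_ode {f : E × E → E} {x y : ℝ → E} {t₀ : ℝ}
    (hf : ContDiffAt ℝ 1 f (x t₀, deriv x t₀)) (hx : ContDiffAt ℝ 2 x t₀)
    (hy : ContDiffAt ℝ 2 y t₀) (hx' : ∀ᶠ t in 𝓝 t₀, deriv (deriv x) t = f (x t, deriv x t))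
    (hy' : ∀ᶠ t in 𝓝 t₀, deriv (deriv y) t = f (y t, deriv y t))
    (h0 : x t₀ = y t₀) (h0' : deriv x t₀ = deriv y t₀) : x =ᶠ[𝓝 t₀] y := by
  -- Reduction to a first-order system for position and velocity.
  have hv : ContDiffAt ℝ 1 (fun p : E × E ↦ (p.2, f p)) (x t₀, deriv x t₀) :=
    contDiffAt_snd.prodMk hf
  obtain ⟨K, s, hs, hK⟩ := hv.exists_lipschitzOnWith
  have key (z : ℝ → E) (hz : ContDiffAt ℝ 2 z t₀) (hz0 : (x t₀, deriv x t₀) = (z t₀, deriv z t₀))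
      (hz' : ∀ᶠ t in 𝓝 t₀, deriv (deriv z) t = f (z t, deriv z t)) :
      ∀ᶠ t in 𝓝 t₀, HasDerivAt (fun t ↦ (z t, deriv z t)) (deriv z t, f (z t, deriv z t)) t ∧
        (z t, deriv z t) ∈ s := by
    have hd : ContDiffAt ℝ 1 (deriv z) t₀ := by
      have := (hz.fderiv_right (m := 1) (by norm_num)).clm_apply (contDiffAt_const (c := (1 : ℝ)))
      simpa only [fderiv_apply_one_eq_deriv] using this
    have hc : ContinuousAt (fun t ↦ (z t, deriv z t)) t₀ :=
      hz.continuousAt.prodMk hd.continuousAt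
    filter_upwards [hz', hz.eventually (by simp), hd.eventually (by simp),
      hc.preimage_mem_nhds (by rw [← hz0]; exact hs)] with t h1 h2 h3 h4
    refine ⟨?_, h4⟩
    rw [← h1]
    exact (h2.differentiableAt two_ne_zero).hasDerivAt.prodMk
      (h3.differentiableAt one_ne_zero).hasDerivAt
  have := ODE_solution_unique_of_eventually (v := fun _ p ↦ (p.2, f p)) (s := fun _ ↦ s)
    (Filter.Eventually.of_forall fun _ ↦ hK) (key x hx rfl hx')
    (key y hy (by rw [h0, h0']) hy') (by simp [h0, h0'])
  filter_upwards [this] with t ht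
  exact congrArg Prod.fst ht

end ODE

/-! ### Geodesics: rescaling, uniqueness, constant speed -/

section Geodesic

variable {E : Type*} [NormedAddCommGroup E] [NormedSpace ℝ E]
  {F : Type*} [NormedAddCommGroup F] [NormedSpace ℝ F]
  {M : Type*} [MetricSpace M] [ChartedSpace E M]

theorem IsLocalParam.eventually_mk_velocity_eq {φ : F → M} {U : Set F} (hφ : IsLocalParam E φ U)
    {γ : ℝ → M} {x : ℝ → F} {t : ℝ} (hx : ContDiffAt ℝ 2 x t) (hxU : x t ∈ U)
    (hγ : γ =ᶠ[𝓝 t] φ ∘ x) :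
    ∀ᶠ r in 𝓝 t, (⟨γ r, velocity γ r⟩ : TangentBundle 𝓘(ℝ, E) M) =
      tangentMap 𝓘(ℝ, F) 𝓘(ℝ, E) φ ⟨x r, deriv x r⟩ := by
  filter_upwards [hγ.eventuallyEq_nhds, hx.eventually (by simp),
    hx.continuousAt.preimage_mem_nhds (hφ.isOpen.mem_nhds hxU)] with r h1 h2 h3
  exact mk_velocity_eq (hφ.mdifferentiableAt h3)
    (h2.differentiableAt two_ne_zero).hasDerivAt h1

theorem contDiffAt_deriv_of_contDiffAt {x : ℝ → F} {t : ℝ} (hx : ContDiffAt ℝ 2 x t) :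
    ContDiffAt ℝ 1 (deriv x) t := by
  have := (hx.fderiv_right (m := 1) (by norm_num)).clm_apply (contDiffAt_const (c := (1 : ℝ)))
  simpa only [fderiv_apply_one_eq_deriv] using this

variable [IsManifold 𝓘(ℝ, E) ∞ M]

theorem mdifferentiable_velocity {γ : ℝ → M} (hγ : ContMDiff 𝓘(ℝ, ℝ) 𝓘(ℝ, E) ∞ γ) :
    MDifferentiable 𝓘(ℝ, ℝ) 𝓘(ℝ, E).tangent
      (fun t ↦ (⟨γ t, velocity γ t⟩ : TangentBundle 𝓘(ℝ, E) M)) := by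
  have h := (contMDiffOn_tangentMap isOpen_univ hγ.contMDiffOn).comp
    (t := univ ×ˢ univ) (s := univ) (f := fun t : ℝ ↦ (t, (1 : ℝ)))
    (contMDiffOn_id.prodMk contMDiffOn_const) (fun y hy ↦ ⟨mem_univ _, mem_univ _⟩)
  exact (contMDiffOn_univ.1 h).mdifferentiable (by simp)

/-- The coordinate expression of a smooth curve. -/
theorem coordinates_of_curve {γ : ℝ → M} (hγ : ContMDiff 𝓘(ℝ, ℝ) 𝓘(ℝ, E) ∞ γ) {x₀ : M} {t : ℝ}
    (ht : γ t ∈ (extChartAt 𝓘(ℝ, E) x₀).source) :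
    ContDiffAt ℝ ∞ (extChartAt 𝓘(ℝ, E) x₀ ∘ γ) t ∧
    (extChartAt 𝓘(ℝ, E) x₀ ∘ γ) t ∈ (extChartAt 𝓘(ℝ, E) x₀).target ∧
    γ =ᶠ[𝓝 t] (extChartAt 𝓘(ℝ, E) x₀).symm ∘ (extChartAt 𝓘(ℝ, E) x₀ ∘ γ) := by
  refine ⟨?_, (extChartAt 𝓘(ℝ, E) x₀).map_source ht, ?_⟩
  · have h1 : ContMDiffAt 𝓘(ℝ, E) 𝓘(ℝ, E) ∞ (extChartAt 𝓘(ℝ, E) x₀) (γ t) :=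
      contMDiffAt_extChartAt' (by simpa using ht)
    exact (h1.comp t hγ.contMDiffAt).contDiffAt
  · filter_upwards [hγ.continuous.continuousAt.preimage_mem_nhds
      ((isOpen_extChartAt_source x₀).mem_nhds ht)] with r hr
    exact ((extChartAt 𝓘(ℝ, E) x₀).left_inv hr).symm

variable [RiemannianBundle (fun x : M ↦ TangentSpace 𝓘(ℝ, E) x)]
  [IsContMDiffRiemannianBundle 𝓘(ℝ, E) ∞ E (fun x : M ↦ TangentSpace 𝓘(ℝ, E) x)]
  [FiniteDimensional ℝ E] [FiniteDimensional ℝ F]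

/-- The geodesic equation in a local parametrization. -/
theorem IsLocalParam.covDerivAlong_velocity_eq_zero_iff {φ : F → M} {U : Set F}
    (hφ : IsLocalParam E φ U) {γ : ℝ → M} {x : ℝ → F} {t : ℝ} (hx : ContDiffAt ℝ 2 x t)
    (hxU : x t ∈ U) (hγ : γ =ᶠ[𝓝 t] φ ∘ x) :
    covDerivAlong (E := E) univ γ (velocity γ) t = 0 ↔
      deriv (deriv x) t =
        -christoffelMap (pullbackMetric (E := E) φ) (x t) (deriv x t) (deriv x t) := by
  rw [hφ.covDerivAlong_eq_zero_iff uniqueDiffWithinAt_univ (mem_univ t) hxU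
    (hx.differentiableAt two_ne_zero).hasDerivAt.hasDerivWithinAt
    ((contDiffAt_deriv_of_contDiffAt hx).differentiableAt
      one_ne_zero).hasDerivAt.hasDerivWithinAt
    (by rw [nhdsWithin_univ]; exact hφ.eventually_mk_velocity_eq hx hxU hγ)]
  exact eq_neg_iff_add_eq_zero.symm

/-- Both sides of the geodesic equation scale by `c ^ 2`, since `Γ` is quadratic in the velocity. -/
theorem IsGeodesic.comp_mul {γ : ℝ → M} (hγ : IsGeodesic E γ) (c : ℝ) :
    IsGeodesic E (fun t ↦ γ (c * t)) := by
  have hs : ContMDiff 𝓘(ℝ, ℝ) 𝓘(ℝ, E) ∞ (fun t ↦ γ (c * t)) :=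
    hγ.1.comp (contDiff_const.mul contDiff_id).contMDiff
  refine ⟨hs, (mdifferentiable_velocity hs).mdifferentiableOn, fun t _ ↦ ?_⟩
  obtain ⟨h1, h2, h3⟩ := coordinates_of_curve hγ.1 (mem_extChartAt_source (I := 𝓘(ℝ, E)) (γ (c * t)))
  set x := extChartAt 𝓘(ℝ, E) (γ (c * t)) ∘ γ with hx
  have hparam := isLocalParam_extChartAt_symm (E := E) (γ (c * t))
  have heq := (hparam.covDerivAlong_velocity_eq_zero_iff (h1.of_le (by norm_cast)) h2 h3).1
    (hγ.2.2 (c * t) (mem_univ _))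
  have hmul : Filter.Tendsto (fun r : ℝ ↦ c * r) (𝓝 t) (𝓝 (c * t)) :=
    (continuous_const.mul continuous_id).tendsto t
  have hd1 : deriv (fun r ↦ x (c * r)) = fun r ↦ c • deriv x (c * r) := by
    ext r; exact deriv_comp_mul_left c x r
  refine (hparam.covDerivAlong_velocity_eq_zero_iff (x := fun r ↦ x (c * r))
    ((h1.of_le (by norm_cast)).comp t (contDiff_const.mul contDiff_id).contDiffAt) h2
    (h3.comp_tendsto hmul)).2 ?_
  have hd2 : deriv (fun r ↦ c • deriv x (c * r)) t = c • c • deriv (deriv x) (c * t) := by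
    rw [deriv_fun_const_smul_field, deriv_comp_mul_left]
  rw [hd1, hd2, heq, christoffelMap_smul]
  simp

/-- Two geodesics with the same coordinates and velocity components at a time agree near it. -/
theorem IsGeodesic.eventuallyEq {γ₁ γ₂ : ℝ → M} (h₁ : IsGeodesic E γ₁) (h₂ : IsGeodesic E γ₂)
    {t : ℝ} (h : γ₁ t = γ₂ t)
    (h' : deriv (extChartAt 𝓘(ℝ, E) (γ₁ t) ∘ γ₁) t = deriv (extChartAt 𝓘(ℝ, E) (γ₁ t) ∘ γ₂) t) :
    γ₁ =ᶠ[𝓝 t] γ₂ := by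
  have : CompleteSpace E := FiniteDimensional.complete ℝ E
  obtain ⟨a1, a2, a3⟩ := coordinates_of_curve h₁.1 (mem_extChartAt_source (I := 𝓘(ℝ, E)) (γ₁ t))
  have hmem : γ₂ t ∈ (extChartAt 𝓘(ℝ, E) (γ₁ t)).source := h ▸ mem_extChartAt_source (γ₁ t)
  obtain ⟨b1, b2, b3⟩ := coordinates_of_curve h₂.1 hmem
  set x := extChartAt 𝓘(ℝ, E) (γ₁ t) ∘ γ₁ with hx
  set y := extChartAt 𝓘(ℝ, E) (γ₁ t) ∘ γ₂ with hy
  have hparam := isLocalParam_extChartAt_symm (E := E) (γ₁ t)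
  set G := pullbackMetric (E := E) (extChartAt 𝓘(ℝ, E) (γ₁ t)).symm with hG
  have hf : ContDiffAt ℝ 1 (fun p : E × E ↦ -christoffelMap G p.1 p.2 p.2) (x t, deriv x t) := by
    have h1 := contDiffAt_christoffelMap (a := deriv x t)
      (hparam.contDiffOn_pullbackMetric.contDiffAt (hparam.isOpen.mem_nhds a2))
      (isInvertible_pullbackMetric (hparam.isInvertible _ a2))
    exact ((h1.clm_apply contDiffAt_snd).neg).of_le (by norm_cast)
  have key {γ : ℝ → M} (hγ : IsGeodesic E γ) {z : ℝ → E} (c1 : ContDiffAt ℝ ∞ z t)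
      (c2 : z t ∈ (extChartAt 𝓘(ℝ, E) (γ₁ t)).target)
      (c3 : γ =ᶠ[𝓝 t] (extChartAt 𝓘(ℝ, E) (γ₁ t)).symm ∘ z) :
      ∀ᶠ r in 𝓝 t, deriv (deriv z) r = -christoffelMap G (z r) (deriv z r) (deriv z r) := by
    filter_upwards [c3.eventuallyEq_nhds, (c1.of_le (m := 2) (by norm_cast)).eventually (by simp),
      c1.continuousAt.preimage_mem_nhds (hparam.isOpen.mem_nhds c2)] with r d1 d2 d3
    exact (hparam.covDerivAlong_velocity_eq_zero_iff d2 d3 d1).1 (hγ.2.2 r (mem_univ r))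
  have hxy : x =ᶠ[𝓝 t] y := eventuallyEq_of_second_order_ode hf (a1.of_le (by norm_cast))
    (b1.of_le (by norm_cast)) (key h₁ a1 a2 a3) (key h₂ b1 b2 b3)
    (congrArg (extChartAt 𝓘(ℝ, E) (γ₁ t)) h) h'
  filter_upwards [a3, b3, hxy] with r e1 e2 e3
  rw [e1, e2, Function.comp_apply, Function.comp_apply, e3]

/-- A geodesic is determined by its initial velocity. -/
theorem IsGeodesic.eq_of_velocity_eq {γ₁ γ₂ : ℝ → M} (h₁ : IsGeodesic E γ₁)
    (h₂ : IsGeodesic E γ₂)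
    (h : (⟨γ₁ 0, velocity γ₁ 0⟩ : TangentBundle 𝓘(ℝ, E) M) = ⟨γ₂ 0, velocity γ₂ 0⟩) :
    γ₁ = γ₂ := by
  -- Connectedness of `ℝ`: the set where the germs agree is open, contains `0`, and is closed
  -- because positions and velocities agree in the limit, which starts local uniqueness again.
  set S : Set ℝ := {t | γ₁ =ᶠ[𝓝 t] γ₂} with hS
  have hSo : IsOpen S := isOpen_setOfPred_eventually_nhds
  have h0 : (0 : ℝ) ∈ S := by
    have hp : γ₁ 0 = γ₂ 0 := congrArg TotalSpace.proj h
    obtain ⟨a1, a2, a3⟩ := coordinates_of_curve h₁.1 (mem_extChartAt_source (I := 𝓘(ℝ, E)) (γ₁ 0))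
    have hmem : γ₂ 0 ∈ (extChartAt 𝓘(ℝ, E) (γ₁ 0)).source := hp ▸ mem_extChartAt_source (γ₁ 0)
    obtain ⟨b1, b2, b3⟩ := coordinates_of_curve h₂.1 hmem
    have hparam := isLocalParam_extChartAt_symm (E := E) (γ₁ 0)
    have hxy : (extChartAt 𝓘(ℝ, E) (γ₁ 0) ∘ γ₁) 0 = (extChartAt 𝓘(ℝ, E) (γ₁ 0) ∘ γ₂) 0 :=
      congrArg (extChartAt 𝓘(ℝ, E) (γ₁ 0)) hp
    have e1 := mk_velocity_eq (hparam.mdifferentiableAt a2)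
      (a1.differentiableAt (by simp)).hasDerivAt a3
    have e2 := mk_velocity_eq (hparam.mdifferentiableAt b2)
      (b1.differentiableAt (by simp)).hasDerivAt b3
    rw [e1, e2, ← hxy] at h
    exact h₁.eventuallyEq h₂ hp
      ((hparam.isInvertible _ a2).injective (TotalSpace.mk_inj.1 h))
  have hclosed : closure S ∩ univ ⊆ S := by
    rintro t ⟨ht, -⟩
    have hp : γ₁ t = γ₂ t := by
      have hc : IsClosed {r | γ₁ r = γ₂ r} := isClosed_eq h₁.1.continuous h₂.1.continuous
      exact closure_minimal (fun r hr ↦ Filter.Eventually.self_of_nhds hr) hc ht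
    obtain ⟨a1, a2, a3⟩ := coordinates_of_curve h₁.1 (mem_extChartAt_source (I := 𝓘(ℝ, E)) (γ₁ t))
    have hmem : γ₂ t ∈ (extChartAt 𝓘(ℝ, E) (γ₁ t)).source := hp ▸ mem_extChartAt_source (γ₁ t)
    obtain ⟨b1, b2, b3⟩ := coordinates_of_curve h₂.1 hmem
    refine h₁.eventuallyEq h₂ hp ?_
    have c1 := (contDiffAt_deriv_of_contDiffAt (a1.of_le (by norm_cast))).continuousAt
    have c2 := (contDiffAt_deriv_of_contDiffAt (b1.of_le (by norm_cast))).continuousAt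
    have : (𝓝[S] t).NeBot := mem_closure_iff_nhdsWithin_neBot.1 ht
    refine tendsto_nhds_unique_of_eventuallyEq (c1.tendsto.mono_left (nhdsWithin_le_nhds (s := S)))
      (c2.tendsto.mono_left nhdsWithin_le_nhds) ?_
    filter_upwards [self_mem_nhdsWithin] with r hr
    exact (Filter.EventuallyEq.fun_comp hr (extChartAt 𝓘(ℝ, E) (γ₁ t))).deriv_eq
  have := isPreconnected_univ.subset_of_closure_inter_subset hSo ⟨0, mem_univ _, h0⟩ hclosed
  funext t
  exact Filter.EventuallyEq.eq_of_nhds (this (mem_univ t))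

/-- Geodesics have constant speed. -/
theorem IsGeodesic.norm_velocity_eq {γ : ℝ → M} (hγ : IsGeodesic E γ) (t : ℝ) :
    ‖velocity (E := E) γ t‖ = ‖velocity (E := E) γ 0‖ := by
  have hd (t : ℝ) : HasDerivAt (fun r ↦ ‖velocity (E := E) γ r‖ ^ 2) 0 t := by
    obtain ⟨a1, a2, a3⟩ := coordinates_of_curve hγ.1 (mem_extChartAt_source (I := 𝓘(ℝ, E)) (γ t))
    set x := extChartAt 𝓘(ℝ, E) (γ t) ∘ γ with hx
    have hparam := isLocalParam_extChartAt_symm (E := E) (γ t)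
    set G := pullbackMetric (E := E) (extChartAt 𝓘(ℝ, E) (γ t)).symm with hG
    have hx2 : ContDiffAt ℝ 2 x t := a1.of_le (by norm_cast)
    have heq : (fun r ↦ ‖velocity (E := E) γ r‖ ^ 2) =ᶠ[𝓝 t]
        fun r ↦ G (x r) (deriv x r) (deriv x r) := by
      filter_upwards [hparam.eventually_mk_velocity_eq hx2 a2 a3] with r hr
      rw [hG, pullbackMetric_apply_self]
      exact congrArg (fun p : TangentBundle 𝓘(ℝ, E) M ↦ ‖p.2‖ ^ 2) hr
    have hge := (hparam.covDerivAlong_velocity_eq_zero_iff hx2 a2 a3).1 (hγ.2.2 t (mem_univ t))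
    have hGd : DifferentiableAt ℝ G (x t) :=
      (hparam.contDiffOn_pullbackMetric.contDiffAt
        (hparam.isOpen.mem_nhds a2)).differentiableAt (by simp)
    have hx1 := (hx2.differentiableAt two_ne_zero).hasDerivAt
    have hx1' := ((contDiffAt_deriv_of_contDiffAt hx2).differentiableAt one_ne_zero).hasDerivAt
    have key := ((hGd.hasFDerivAt.comp_hasDerivAt t hx1).clm_apply hx1').clm_apply hx1'
    -- With all three arguments equal to `x'`, Koszul gives `2 G(Γ(x', x'), x') = ∂_{x'} G(x', x')`,
    -- which cancels the terms from `x'' = -Γ(x', x')`.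
    have happ := apply_christoffelMap (isInvertible_pullbackMetric (hparam.isInvertible _ a2))
      (deriv x t) (deriv x t) (deriv x t)
    have hcomm := pullbackMetric_comm (E := E) (extChartAt 𝓘(ℝ, E) (γ t)).symm (x t) (deriv x t)
      (christoffelMap G (x t) (deriv x t) (deriv x t))
    refine (key.congr_of_eventuallyEq heq).congr_deriv ?_
    simp only [add_apply, Function.comp_apply]
    rw [hge]
    simp only [map_neg, neg_apply, ← hG] at happ hcomm ⊢
    linarith
  have h := is_const_of_deriv_eq_zero (fun r ↦ (hd r).differentiableAt) (fun r ↦ (hd r).deriv) t 0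
  exact (sq_eq_sq₀ (norm_nonneg _) (norm_nonneg _)).1 h

end Geodesic

/-! ### The Gauss lemma -/

section Gauss

variable {F : Type*} [NormedAddCommGroup F] [InnerProductSpace ℝ F]

/-- If the rays from the origin satisfy the geodesic equation of `G` on a ball, then radial vectors
have the same inner products for `G` as at the origin. -/
theorem gauss_lemma {G : F → F →L[ℝ] F →L[ℝ] ℝ} {r : ℝ}
    (hG : ∀ y ∈ Metric.ball (0 : F) r, DifferentiableAt ℝ G y)
    (hsymm : ∀ y a b, G y a b = G y b a)
    (hinv : ∀ y ∈ Metric.ball (0 : F) r, (G y).IsInvertible)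
    (hgeo : ∀ (v : F) (t : ℝ), t • v ∈ Metric.ball (0 : F) r → christoffelMap G (t • v) v v = 0)
    {y : F} (hy : y ∈ Metric.ball (0 : F) r) (w : F) : G y y w = G 0 y w := by
  have hball {z : F} (hz : z ∈ Metric.ball (0 : F) r) {t : ℝ} (ht : t ∈ Icc (0 : ℝ) 1) :
      t • z ∈ Metric.ball (0 : F) r := by
    rw [mem_ball_zero_iff] at hz ⊢
    rw [norm_smul, Real.norm_of_nonneg ht.1]
    exact (mul_le_of_le_one_left (norm_nonneg z) ht.2).trans_lt hz
  -- The geodesic equation of the ray, paired with `w`. Taking `w = v` gives `∂_v G(v, v) = 0`,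
  -- hence `hspeed`.
  have hform {v : F} {t : ℝ} (h : t • v ∈ Metric.ball (0 : F) r) (w : F) :
      2 * fderiv ℝ G (t • v) v v w = fderiv ℝ G (t • v) w v v := by
    have h1 := apply_christoffelMap (hinv _ h) v v w
    rw [hgeo v t h] at h1
    simp only [map_zero, zero_apply] at h1
    linarith
  have hray (v a b : F) {t : ℝ} (h : t • v ∈ Metric.ball (0 : F) r) :
      HasDerivAt (fun s : ℝ ↦ G (s • v) a b) (fderiv ℝ G (t • v) v a b) t := by
    have h1 : HasDerivAt (fun s : ℝ ↦ s • v) v t := by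
      simpa using (hasDerivAt_id t).smul_const v
    have h2 := (hG _ h).hasFDerivAt.comp_hasDerivAt t h1
    simpa using (h2.clm_apply (hasDerivAt_const t a)).clm_apply (hasDerivAt_const t b)
  have hspeed {z : F} (hz : z ∈ Metric.ball (0 : F) r) : G z z z = G 0 z z := by
    have h1 (t : ℝ) (ht : t ∈ Icc (0 : ℝ) 1) : HasDerivAt (fun s : ℝ ↦ G (s • z) z z) 0 t :=
      (hray z z z (hball hz ht)).congr_deriv (by linarith [hform (hball hz ht) z])
    have h2 := constant_of_has_deriv_right_zero
      (fun t ht ↦ (h1 t ht).continuousAt.continuousWithinAt)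
      (fun t ht ↦ (h1 t (Ico_subset_Icc_self ht)).hasDerivWithinAt) 1 (by simp)
    simpa using h2
  -- The identity `G_z(z, z) = G_0(z, z)` holds on an open ball, so it may be differentiated at `z =
  -- t • y` in the direction `w`.
  have hvar {t : ℝ} (ht : t ∈ Icc (0 : ℝ) 1) :
      t ^ 2 * fderiv ℝ G (t • y) w y y + 2 * t * G (t • y) y w = 2 * t * G 0 y w := by
    have hmem := hball hy ht
    have hid : HasFDerivAt (fun z : F ↦ z) (ContinuousLinearMap.id ℝ F) (t • y) :=
      hasFDerivAt_id (t • y)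
    have h1 := ((hG _ hmem).hasFDerivAt.clm_apply hid).clm_apply hid
    have h2 := ((hasFDerivAt_const (G 0) (t • y)).clm_apply hid).clm_apply hid
    have h3 : (fun z ↦ G z z z) =ᶠ[𝓝 (t • y)] fun z ↦ G 0 z z := by
      filter_upwards [Metric.isOpen_ball.mem_nhds hmem] with z hz using hspeed hz
    have h4 := congrArg (fun L : F →L[ℝ] ℝ ↦ L w) (h1.unique (h2.congr_of_eventuallyEq h3))
    simp at h4
    rw [hsymm (t • y) w y, hsymm 0 w y] at h4
    linarith
  -- By `hvar` and `hform`, `2t` times this derivative vanishes; the factor `s` makes the value at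
  -- `t = 0` immediate.
  have hk (t : ℝ) (ht : t ∈ Icc (0 : ℝ) 1) :
      HasDerivAt (fun s : ℝ ↦ s * G (s • y) y w - s * G 0 y w) 0 t := by
    have h1 := ((hasDerivAt_id t).mul (hray y y w (hball hy ht))).sub
      ((hasDerivAt_id t).mul_const (G 0 y w))
    refine h1.congr_deriv ?_
    have h2 := hvar ht
    rw [← hform (hball hy ht) w] at h2
    simp only [id, one_mul]
    rcases eq_or_ne t 0 with rfl | h0
    · simp
    · apply mul_left_cancel₀ (mul_ne_zero two_ne_zero h0)
      linarith
  have h2 := constant_of_has_deriv_right_zero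
    (fun t ht ↦ (hk t ht).continuousAt.continuousWithinAt)
    (fun t ht ↦ (hk t (Ico_subset_Icc_self ht)).hasDerivWithinAt) 1 (by simp)
  simp only [one_smul, one_mul, zero_mul, sub_self] at h2
  linarith

end Gauss

/-! ### Lengths of curves in normal coordinates -/

section NormalCoordinates

variable {E : Type*} [NormedAddCommGroup E] [NormedSpace ℝ E]
  {F : Type*} [NormedAddCommGroup F] [InnerProductSpace ℝ F]
  {M : Type*} [MetricSpace M] [ChartedSpace E M]

theorem isLocalParam_partialDiffeomorph (Φ : PartialDiffeomorph 𝓘(ℝ, F) 𝓘(ℝ, E) F M ∞) :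
    IsLocalParam E Φ Φ.source where
  isOpen := Φ.open_source
  contMDiffOn := Φ.contMDiffOn
  isInvertible y hy :=
    ⟨(Φ.isLocalDiffeomorphAt _ _ _ hy).mfderivToContinuousLinearEquiv (by simp), rfl⟩

variable [IsManifold 𝓘(ℝ, E) ∞ M]
  [RiemannianBundle (fun x : M ↦ TangentSpace 𝓘(ℝ, E) x)]
  [IsContMDiffRiemannianBundle 𝓘(ℝ, E) ∞ E (fun x : M ↦ TangentSpace 𝓘(ℝ, E) x)]

theorem continuous_norm_velocity {c : ℝ → M} (hc : ContMDiff 𝓘(ℝ, ℝ) 𝓘(ℝ, E) 1 c) :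
    Continuous (fun t ↦ ‖velocity (E := E) c t‖) := by
  have h1 : Continuous (fun t ↦ (⟨c t, velocity c t⟩ : TangentBundle 𝓘(ℝ, E) M)) :=
    (hc.continuous_tangentMap le_rfl).comp
      ((tangentBundleModelSpaceHomeomorph 𝓘(ℝ, ℝ)).symm.continuous.comp
        (continuous_id.prodMk (continuous_const (y := (1 : ℝ)))))
  have h2 : Continuous (fun t ↦ metricAt (E := E) (c t) (velocity c t) (velocity c t)) := by
    have := ContMDiff.inner_bundle (n := 0) (IB := 𝓘(ℝ, E)) (IM := 𝓘(ℝ, ℝ)) (F := E)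
      (E := fun x : M ↦ TangentSpace 𝓘(ℝ, E) x) (b := c) (v := fun t ↦ velocity c t)
      (w := fun t ↦ velocity c t) (contMDiff_zero_iff.2 h1) (contMDiff_zero_iff.2 h1)
    exact this.continuous
  refine (h2.sqrt).congr fun t ↦ ?_
  have : metricAt (E := E) (c t) (velocity c t) (velocity c t) = ‖velocity (E := E) c t‖ ^ 2 :=
    real_inner_self_eq_norm_sq (F := TangentSpace 𝓘(ℝ, E) (c t)) _
  rw [this, Real.sqrt_sq (norm_nonneg _)]

theorem pathELength_eq_ofReal_integral {c : ℝ → M} (hc : ContMDiff 𝓘(ℝ, ℝ) 𝓘(ℝ, E) 1 c) :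
    pathELength 𝓘(ℝ, E) c 0 1 = ENNReal.ofReal (∫ t in (0 : ℝ)..1, ‖velocity (E := E) c t‖) := by
  rw [pathELength_eq_lintegral_mfderiv_Icc, intervalIntegral.integral_of_le zero_le_one,
    ← MeasureTheory.integral_Icc_eq_integral_Ioc,
    MeasureTheory.ofReal_integral_eq_lintegral_ofReal
      ((continuous_norm_velocity hc).integrableOn_Icc)
      (Filter.Eventually.of_forall fun _ ↦ norm_nonneg _)]
  refine MeasureTheory.lintegral_congr fun t ↦ ?_
  exact (ofReal_norm (velocity (E := E) c t)).symm

variable {Φ : PartialDiffeomorph 𝓘(ℝ, F) 𝓘(ℝ, E) F M ∞} {r : ℝ}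

/-- The distance to the origin in normal coordinates is at most the length of a curve. -/
theorem norm_le_integral_of_mem_target (hΦ : Φ.source = Metric.ball 0 r)
    (hrad : ∀ y ∈ Metric.ball (0 : F) r, ∀ w, pullbackMetric (E := E) Φ y y w = inner ℝ y w)
    {c : ℝ → M} (hc : ContMDiff 𝓘(ℝ, ℝ) 𝓘(ℝ, E) 1 c) (hc0 : Φ.symm (c 0) = 0) {T : ℝ}
    (hT : 0 ≤ T) (hcT : ∀ t ∈ Icc 0 T, c t ∈ Φ.target) :
    ‖Φ.symm (c T)‖ ≤ ∫ t in (0 : ℝ)..T, ‖velocity (E := E) c t‖ := by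
  have hparam := isLocalParam_partialDiffeomorph Φ
  set x : ℝ → F := Φ.symm ∘ c with hx
  have hxd (t : ℝ) (ht : t ∈ Icc 0 T) : HasDerivAt x (deriv x t) t := by
    have h1 : ContMDiffAt 𝓘(ℝ, E) 𝓘(ℝ, F) ∞ Φ.symm (c t) :=
      Φ.contMDiffOn_invFun.contMDiffAt (Φ.open_target.mem_nhds (hcT t ht))
    have h2 : ContMDiffAt 𝓘(ℝ, ℝ) 𝓘(ℝ, F) 1 x t :=
      (h1.of_le (by norm_cast)).comp t hc.contMDiffAt
    exact (h2.contDiffAt.differentiableAt one_ne_zero).hasDerivAt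
  -- The radial identity turns the Euclidean product into the Riemannian one, where Cauchy–Schwarz
  -- applies; the radial vector has the same norm in both.
  have hbound (t : ℝ) (ht : t ∈ Icc 0 T) :
      inner ℝ (x t) (deriv x t) ≤ ‖x t‖ * ‖velocity (E := E) c t‖ := by
    have hxs : x t ∈ Φ.source := Φ.map_target (hcT t ht)
    have hxb : x t ∈ Metric.ball (0 : F) r := hΦ ▸ hxs
    have hcongr : c =ᶠ[𝓝 t] Φ ∘ x := by
      filter_upwards [hc.continuous.continuousAt.preimage_mem_nhds
        (Φ.open_target.mem_nhds (hcT t ht))] with s hs using (Φ.right_inv hs).symm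
    have hvel := mk_velocity_eq (hparam.mdifferentiableAt hxs) (hxd t ht) hcongr
    have hnorm : ‖velocity (E := E) c t‖ =
        ‖mfderiv 𝓘(ℝ, F) 𝓘(ℝ, E) Φ (x t) (deriv x t)‖ :=
      congrArg (fun p : TangentBundle 𝓘(ℝ, E) M ↦ ‖p.2‖) hvel
    have hself : ‖mfderiv 𝓘(ℝ, F) 𝓘(ℝ, E) Φ (x t) (x t)‖ = ‖x t‖ := by
      have h1 := hrad _ hxb (x t)
      rw [pullbackMetric_apply_self, real_inner_self_eq_norm_sq] at h1
      exact (sq_eq_sq₀ (norm_nonneg _) (norm_nonneg _)).1 h1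
    rw [← hrad _ hxb, hnorm, ← hself]
    exact real_inner_le_norm (F := TangentSpace 𝓘(ℝ, E) (Φ (x t))) _ _
  -- The `ε` smooths the norm where the curve meets the origin; afterwards `ε → 0`.
  have hsq (ε : ℝ) (hε : 0 < ε) :
      √(‖x T‖ ^ 2 + ε) - √(‖x 0‖ ^ 2 + ε) ≤ ∫ t in (0 : ℝ)..T, ‖velocity (E := E) c t‖ := by
    have hpos (t : ℝ) : 0 < ‖x t‖ ^ 2 + ε := by positivity
    have hder (t : ℝ) (ht : t ∈ Icc 0 T) : HasDerivAt (fun s ↦ √(‖x s‖ ^ 2 + ε))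
        (2 * inner ℝ (x t) (deriv x t) / (2 * √(‖x t‖ ^ 2 + ε))) t :=
      ((hxd t ht).norm_sq.add_const ε).sqrt (hpos t).ne'
    refine intervalIntegral.sub_le_integral_of_hasDeriv_right_of_le hT
      (fun t ht ↦ (hder t ht).continuousAt.continuousWithinAt)
      (fun t ht ↦ (hder t (Ioo_subset_Icc_self ht)).hasDerivWithinAt)
      ((continuous_norm_velocity hc).integrableOn_Icc) (fun t ht ↦ ?_)
    have h1 := hbound t (Ioo_subset_Icc_self ht)
    have h2 : ‖x t‖ ≤ √(‖x t‖ ^ 2 + ε) := Real.le_sqrt_of_sq_le (by linarith)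
    have h3 : 0 < √(‖x t‖ ^ 2 + ε) := Real.sqrt_pos.2 (hpos t)
    rw [div_le_iff₀ (by positivity)]
    have h4 := mul_le_mul_of_nonneg_right h2 (norm_nonneg (velocity (E := E) c t))
    linarith
  have hx0 : x 0 = 0 := hc0
  have hlim : Filter.Tendsto (fun ε : ℝ ↦ √(‖x T‖ ^ 2 + ε) - √(‖x 0‖ ^ 2 + ε)) (𝓝[>] 0)
      (𝓝 ‖x T‖) := by
    have hcont : Continuous (fun ε : ℝ ↦ √(‖x T‖ ^ 2 + ε) - √(‖x 0‖ ^ 2 + ε)) := by fun_prop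
    have h := (hcont.tendsto 0).mono_left (nhdsWithin_le_nhds (s := Ioi 0))
    simpa [hx0, Real.sqrt_sq (norm_nonneg (x T))] using h
  exact le_of_tendsto hlim (by filter_upwards [self_mem_nhdsWithin] with ε hε using hsq ε hε)

variable [FiniteDimensional ℝ F]

/-- A curve from the centre that is shorter than the radius of a normal ball stays in the ball. -/
theorem exists_eq_of_pathELength_lt (hΦ : Φ.source = Metric.ball 0 r)
    (hrad : ∀ y ∈ Metric.ball (0 : F) r, ∀ w, pullbackMetric (E := E) Φ y y w = inner ℝ y w)
    {c : ℝ → M} (hc : ContMDiff 𝓘(ℝ, ℝ) 𝓘(ℝ, E) 1 c) (hc0 : c 0 = Φ 0) {R : ℝ} (hRr : R ≤ r)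
    (hlen : pathELength 𝓘(ℝ, E) c 0 1 < ENNReal.ofReal R) :
    ∃ y : F, ‖y‖ < R ∧ c 1 = Φ y := by
  have hR : 0 < R := ENNReal.ofReal_pos.1 ((zero_le).trans_lt hlen)
  have h0 : (0 : F) ∈ Φ.source := by rw [hΦ]; exact Metric.mem_ball_self (hR.trans_le hRr)
  set ℓ := ∫ t in (0 : ℝ)..1, ‖velocity (E := E) c t‖ with hℓ
  have hℓR : ℓ < R := by
    rw [pathELength_eq_ofReal_integral hc] at hlen
    exact (ENNReal.ofReal_lt_ofReal_iff hR).1 hlen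
  have hmono {T : ℝ} (hT : T ∈ Icc (0 : ℝ) 1) (hcT : ∀ t ∈ Icc 0 T, c t ∈ Φ.target) :
      ‖Φ.symm (c T)‖ ≤ ℓ := by
    refine (norm_le_integral_of_mem_target hΦ hrad hc ?_ hT.1 hcT).trans ?_
    · rw [hc0]; exact Φ.left_inv h0
    · exact intervalIntegral.integral_mono_interval le_rfl hT.1 hT.2
        (Filter.Eventually.of_forall fun _ ↦ norm_nonneg _)
        ((continuous_norm_velocity hc).intervalIntegrable _ _)
  have hsub : Metric.closedBall (0 : F) ℓ ⊆ Φ.source := by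
    rw [hΦ]
    exact Metric.closedBall_subset_ball (hℓR.trans_le hRr)
  have hK : IsClosed (Φ '' Metric.closedBall (0 : F) ℓ) := by
    have : ProperSpace F := FiniteDimensional.proper ℝ F
    exact ((isCompact_closedBall 0 ℓ).image_of_continuousOn
      (Φ.contMDiffOn.continuousOn.mono hsub)).isClosed
  have hall : ∀ t ∈ Icc (0 : ℝ) 1, c t ∈ Φ.target := by
    by_contra! hne
    -- Consider the first exit time `τ`. Before it the curve stays in the image of the closed
    -- `ℓ`-ball, which is compact, hence closed, so `c τ` lies there as well: a contradiction.
    set Z := Icc (0 : ℝ) 1 ∩ c ⁻¹' (Φ.target)ᶜ with hZ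
    have hZc : IsCompact Z :=
      isCompact_Icc.inter_right (Φ.open_target.isClosed_compl.preimage hc.continuous)
    obtain ⟨τ, hτ, hmin⟩ := hZc.exists_isLeast (by
      obtain ⟨t, ht, ht'⟩ := hne
      exact ⟨t, ht, ht'⟩)
    have hτ0 : 0 < τ := by
      refine lt_of_le_of_ne hτ.1.1 ?_
      rintro rfl
      exact hτ.2 (by rw [hc0]; exact Φ.map_source h0)
    have hbefore (t : ℝ) (ht : t ∈ Ico 0 τ) : c t ∈ Φ.target := by
      by_contra h
      exact ht.2.not_ge (hmin ⟨⟨ht.1, ht.2.le.trans hτ.1.2⟩, h⟩)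
    have hin (t : ℝ) (ht : t ∈ Ico 0 τ) : c t ∈ Φ '' Metric.closedBall (0 : F) ℓ := by
      refine ⟨Φ.symm (c t), ?_, Φ.right_inv (hbefore t ht)⟩
      rw [mem_closedBall_zero_iff]
      exact hmono ⟨ht.1, ht.2.le.trans hτ.1.2⟩ fun s hs ↦ hbefore s ⟨hs.1, hs.2.trans_lt ht.2⟩
    have hτK : c τ ∈ Φ '' Metric.closedBall (0 : F) ℓ := by
      have hcl : τ ∈ closure (Ico 0 τ) := by
        rw [closure_Ico hτ0.ne]
        exact ⟨hτ0.le, le_rfl⟩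
      exact closure_minimal hin (hK.preimage hc.continuous) hcl
    obtain ⟨y, hy, hyτ⟩ := hτK
    exact hτ.2 (hyτ ▸ Φ.map_source (hsub hy))
  refine ⟨Φ.symm (c 1), (hmono (by simp) hall).trans_lt hℓR, ?_⟩
  exact (Φ.right_inv (hall 1 (by simp))).symm

variable [FiniteDimensional ℝ E]

/-- Radial vectors in normal coordinates. -/
theorem pullbackMetric_radial (hΦ : Φ.source = Metric.ball 0 r)
    (h0 : ∀ a b, pullbackMetric (E := E) Φ 0 a b = inner ℝ a b)
    (hgeo : ∀ v : F, ∃ γ : ℝ → M, IsGeodesic E γ ∧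
      ∀ t : ℝ, t • v ∈ Metric.ball 0 r → γ t = Φ (t • v))
    {y : F} (hy : y ∈ Metric.ball 0 r) (w : F) :
    pullbackMetric (E := E) Φ y y w = inner ℝ y w := by
  have hparam := isLocalParam_partialDiffeomorph Φ
  rw [hΦ] at hparam
  rw [← h0]
  refine gauss_lemma
    (fun z hz ↦ (hparam.contDiffOn_pullbackMetric.contDiffAt
      (hparam.isOpen.mem_nhds hz)).differentiableAt (by simp))
    (pullbackMetric_comm _)
    (fun z hz ↦ isInvertible_pullbackMetric (hparam.isInvertible z hz))
    (fun v t ht ↦ ?_) hy w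
  obtain ⟨γ, hγ, hγΦ⟩ := hgeo v
  have hx : ContDiff ℝ 2 (fun s : ℝ ↦ s • v) := contDiff_id.smul contDiff_const
  have hd : deriv (fun s : ℝ ↦ s • v) = fun _ ↦ v := by
    ext s
    simpa using ((hasDerivAt_id s).smul_const v).deriv
  have hcongr : γ =ᶠ[𝓝 t] Φ ∘ fun s : ℝ ↦ s • v := by
    filter_upwards [hx.continuous.continuousAt.preimage_mem_nhds
      (hparam.isOpen.mem_nhds ht)] with s hs using hγΦ s hs
  have h := (hparam.covDerivAlong_velocity_eq_zero_iff (x := fun s : ℝ ↦ s • v) hx.contDiffAt ht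
    hcongr).1 (hγ.2.2 t (mem_univ t))
  rw [hd] at h
  simpa using h.symm

end NormalCoordinates

/-! ### Distance and minimal geodesics from the centre of a normal chart -/

section NormalChart

variable {E : Type*} [NormedAddCommGroup E] [NormedSpace ℝ E]
  {F : Type*} [NormedAddCommGroup F] [InnerProductSpace ℝ F]
  {M : Type*} [MetricSpace M] [ChartedSpace E M] [IsManifold 𝓘(ℝ, E) ∞ M]
  [RiemannianBundle (fun x : M ↦ TangentSpace 𝓘(ℝ, E) x)]

/-- `Φ` is a normal coordinate system on the ball of radius `r`: an isometry at the origin that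
maps rays to geodesics. -/
structure IsNormalChart (Φ : PartialDiffeomorph 𝓘(ℝ, F) 𝓘(ℝ, E) F M ∞) (r : ℝ) : Prop where
  pos : 0 < r
  source_eq : Φ.source = Metric.ball 0 r
  metric_zero : ∀ a b, pullbackMetric (E := E) Φ 0 a b = inner ℝ a b
  exists_geodesic : ∀ v : F, ∃ γ : ℝ → M, IsGeodesic E γ ∧
    ∀ t : ℝ, t • v ∈ Metric.ball 0 r → γ t = Φ (t • v)

variable {Φ : PartialDiffeomorph 𝓘(ℝ, F) 𝓘(ℝ, E) F M ∞} {r : ℝ}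

theorem smul_mem_ball {y : F} (hy : y ∈ Metric.ball (0 : F) r) {t : ℝ} (ht : t ∈ Icc (0 : ℝ) 1) :
    t • y ∈ Metric.ball (0 : F) r := by
  rw [mem_ball_zero_iff] at hy ⊢
  rw [norm_smul, Real.norm_of_nonneg ht.1]
  exact (mul_le_of_le_one_left (norm_nonneg y) ht.2).trans_lt hy

theorem IsNormalChart.isLocalParam (h : IsNormalChart Φ r) :
    IsLocalParam E Φ (Metric.ball 0 r) :=
  h.source_eq ▸ isLocalParam_partialDiffeomorph Φ

theorem IsNormalChart.mk_velocity_zero (h : IsNormalChart Φ r) {v : F} {γ : ℝ → M}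
    (hγ : ∀ t : ℝ, t • v ∈ Metric.ball 0 r → γ t = Φ (t • v)) :
    (⟨γ 0, velocity γ 0⟩ : TangentBundle 𝓘(ℝ, E) M) = tangentMap 𝓘(ℝ, F) 𝓘(ℝ, E) Φ ⟨0, v⟩ := by
  have hx : HasDerivAt (fun s : ℝ ↦ s • v) v 0 := by
    simpa using (hasDerivAt_id (0 : ℝ)).smul_const v
  have h0 : (0 : ℝ) • v ∈ Metric.ball (0 : F) r := by
    rw [zero_smul]; exact Metric.mem_ball_self h.pos
  have := mk_velocity_eq (x := fun s : ℝ ↦ s • v) (h.isLocalParam.mdifferentiableAt h0) hx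
    (γ := γ) (by
      filter_upwards [hx.continuousAt.preimage_mem_nhds (Metric.isOpen_ball.mem_nhds h0)]
        with s hs using hγ s hs)
  rwa [zero_smul] at this

theorem IsNormalChart.norm_velocity_zero (h : IsNormalChart Φ r) {v : F} {γ : ℝ → M}
    (hγ : ∀ t : ℝ, t • v ∈ Metric.ball 0 r → γ t = Φ (t • v)) :
    ‖velocity (E := E) γ 0‖ = ‖v‖ := by
  have h1 : ‖velocity (E := E) γ 0‖ = ‖mfderiv 𝓘(ℝ, F) 𝓘(ℝ, E) Φ 0 v‖ :=
    congrArg (fun p : TangentBundle 𝓘(ℝ, E) M ↦ ‖p.2‖) (h.mk_velocity_zero hγ)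
  have h2 := h.metric_zero v v
  rw [pullbackMetric_apply_self, real_inner_self_eq_norm_sq, ← h1] at h2
  exact (sq_eq_sq₀ (norm_nonneg _) (norm_nonneg _)).1 h2

variable [IsContMDiffRiemannianBundle 𝓘(ℝ, E) ∞ E (fun x : M ↦ TangentSpace 𝓘(ℝ, E) x)]
  [FiniteDimensional ℝ E]

theorem IsGeodesic.pathELength_eq {γ : ℝ → M} (hγ : IsGeodesic E γ) :
    pathELength 𝓘(ℝ, E) γ 0 1 = ENNReal.ofReal ‖velocity (E := E) γ 0‖ := by
  rw [pathELength_eq_ofReal_integral (hγ.1.of_le (by norm_cast))]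
  simp_rw [hγ.norm_velocity_eq]
  simp

/-- In normal coordinates the geodesics from the centre are the rays. -/
theorem IsNormalChart.exists_eq_of_isGeodesic (h : IsNormalChart Φ r) {γ : ℝ → M}
    (hγ : IsGeodesic E γ) (hγ0 : γ 0 = Φ 0) :
    ∃ v : F, ∀ t : ℝ, t • v ∈ Metric.ball 0 r → γ t = Φ (t • v) := by
  obtain ⟨v, hv⟩ := (h.isLocalParam.isInvertible 0 (Metric.mem_ball_self h.pos)).surjective
    (velocity (E := E) γ 0 : E)
  obtain ⟨γ', hγ', hγ'Φ⟩ := h.exists_geodesic v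
  have heq : γ = γ' := by
    refine hγ.eq_of_velocity_eq hγ' ?_
    rw [h.mk_velocity_zero hγ'Φ]
    unfold tangentMap
    rw [hv, hγ0]
  exact ⟨v, heq ▸ hγ'Φ⟩

variable [FiniteDimensional ℝ F]

theorem IsNormalChart.radial (h : IsNormalChart Φ r) {y : F} (hy : y ∈ Metric.ball (0 : F) r)
    (w : F) : pullbackMetric (E := E) Φ y y w = inner ℝ y w :=
  pullbackMetric_radial h.source_eq h.metric_zero h.exists_geodesic hy w

variable [IsRiemannianManifold 𝓘(ℝ, E) M]

/-- The distance is an infimum of lengths, so some `C¹` curve to `q` is shorter than `R`, and such a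
curve cannot leave the normal ball. -/
theorem IsNormalChart.exists_norm_lt (h : IsNormalChart Φ r) {q : M} {R : ℝ} (hRr : R ≤ r)
    (hq : dist (Φ 0) q < R) : ∃ y : F, ‖y‖ < R ∧ q = Φ y := by
  have h1 : riemannianEDist 𝓘(ℝ, E) (Φ 0) q < ENNReal.ofReal R := by
    rw [← IsRiemannianManifold.out (I := 𝓘(ℝ, E)), edist_dist]
    exact (ENNReal.ofReal_lt_ofReal_iff (dist_nonneg.trans_lt hq)).2 hq
  obtain ⟨c, hc0, hc1, hc, hlen, -, -⟩ :=
    exists_lt_locally_constant_of_riemannianEDist_lt h1 zero_lt_one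
  obtain ⟨y, hy, hyc⟩ := exists_eq_of_pathELength_lt h.source_eq (fun _ hy w ↦ h.radial hy w)
    hc hc0 hRr hlen
  exact ⟨y, hy, hc1 ▸ hyc⟩

/-- In normal coordinates the distance to the centre is the norm. -/
theorem IsNormalChart.dist_eq_norm (h : IsNormalChart Φ r) {y : F}
    (hy : y ∈ Metric.ball (0 : F) r) : dist (Φ 0) (Φ y) = ‖y‖ := by
  obtain ⟨γ, hγ, hγΦ⟩ := h.exists_geodesic y
  have h0 : γ 0 = Φ 0 := by
    have := hγΦ 0 (by rw [zero_smul]; exact Metric.mem_ball_self h.pos)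
    rwa [zero_smul] at this
  have h1 : γ 1 = Φ y := by
    have := hγΦ 1 (by rwa [one_smul])
    rwa [one_smul] at this
  apply le_antisymm
  · have hle : edist (Φ 0) (Φ y) ≤ ENNReal.ofReal ‖y‖ := by
      rw [IsRiemannianManifold.out (I := 𝓘(ℝ, E)), ← h.norm_velocity_zero hγΦ,
        ← hγ.pathELength_eq]
      exact riemannianEDist_le_pathELength (hγ.1.of_le (by norm_cast)).contMDiffOn h0 h1
        zero_le_one
    rw [edist_dist] at hle
    exact (ENNReal.ofReal_le_ofReal_iff (norm_nonneg y)).1 hle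
  -- A smaller distance would make `Φ y` also the image of a vector shorter than `y`, against
  -- injectivity.
  · by_contra! hlt
    have hyr : ‖y‖ < r := mem_ball_zero_iff.1 hy
    obtain ⟨y', hy', hyy'⟩ := h.exists_norm_lt hyr.le hlt
    have hinj := Φ.injOn (h.source_eq ▸ hy)
      (h.source_eq ▸ mem_ball_zero_iff.2 (hy'.trans hyr)) hyy'
    rw [← hinj] at hy'
    exact lt_irrefl _ hy'

/-- A geodesic from the centre is a ray with some direction `v` and has length `‖v‖`. Minimality
forces `‖v‖ = ‖y‖`, so `v` lies in the ball and injectivity of `Φ` gives `v = y`. -/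
theorem IsNormalChart.isMinimalGeodesic_iff (h : IsNormalChart Φ r) {y : F}
    (hy : y ∈ Metric.ball (0 : F) r) {γ : ℝ → M} :
    IsMinimalGeodesic E (Φ 0) (Φ y) γ ↔
      IsGeodesic E γ ∧ ∀ t : ℝ, t • y ∈ Metric.ball 0 r → γ t = Φ (t • y) := by
  have hed : edist (Φ 0) (Φ y) = ENNReal.ofReal ‖y‖ := by
    rw [edist_dist, h.dist_eq_norm hy]
  constructor
  · rintro ⟨hγ, h0, h1, hlen⟩
    refine ⟨hγ, ?_⟩
    obtain ⟨v, hv⟩ := h.exists_eq_of_isGeodesic hγ h0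
    rw [hγ.pathELength_eq, h.norm_velocity_zero hv, hed,
      ENNReal.ofReal_eq_ofReal_iff (norm_nonneg v) (norm_nonneg y)] at hlen
    have hvr : v ∈ Metric.ball (0 : F) r := by
      rw [mem_ball_zero_iff] at hy ⊢
      rwa [hlen]
    have hv1 := hv 1 (by rwa [one_smul])
    rw [one_smul, h1] at hv1
    have hinj : y = v := Φ.injOn (h.source_eq ▸ hy) (h.source_eq ▸ hvr) hv1
    rwa [hinj]
  · rintro ⟨hγ, hγΦ⟩
    refine ⟨hγ, ?_, ?_, ?_⟩
    · have := hγΦ 0 (by rw [zero_smul]; exact Metric.mem_ball_self h.pos)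
      rwa [zero_smul] at this
    · have := hγΦ 1 (by rwa [one_smul])
      rwa [one_smul] at this
    · rw [hγ.pathELength_eq, h.norm_velocity_zero hγΦ, hed]

theorem IsNormalChart.existsUnique_isMinimalGeodesic (h : IsNormalChart Φ r) {y : F}
    (hy : y ∈ Metric.ball (0 : F) r) : ∃! γ : ℝ → M, IsMinimalGeodesic E (Φ 0) (Φ y) γ := by
  simp only [h.isMinimalGeodesic_iff hy]
  obtain ⟨γ, hγ, hγΦ⟩ := h.exists_geodesic y
  refine ⟨γ, ⟨hγ, hγΦ⟩, fun γ' hγ' ↦ hγ'.1.eq_of_velocity_eq hγ ?_⟩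
  rw [h.mk_velocity_zero hγΦ, h.mk_velocity_zero hγ'.2]

end NormalChart

/-- Changes the base point along an equality without a cast, as every tangent space is `E` by
definition. -/
theorem mk_eq_of_proj_eq {E : Type*} [NormedAddCommGroup E] [NormedSpace ℝ E]
    {M : Type*} [TopologicalSpace M] [ChartedSpace E M] {v : TangentBundle 𝓘(ℝ, E) M} {q : M}
    (h : v.1 = q) : (⟨q, (v.2 : E)⟩ : TangentBundle 𝓘(ℝ, E) M) = v := by
  subst h
  rfl

/-! ### From solutions of the linear equation to parallel fields -/

section Transport

variable {E : Type*} [NormedAddCommGroup E] [NormedSpace ℝ E]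
  {F : Type*} [NormedAddCommGroup F] [NormedSpace ℝ F]
  {M : Type*} [MetricSpace M] [ChartedSpace E M] [IsManifold 𝓘(ℝ, E) ∞ M]
  [RiemannianBundle (fun x : M ↦ TangentSpace 𝓘(ℝ, E) x)]
  [IsContMDiffRiemannianBundle 𝓘(ℝ, E) ∞ E (fun x : M ↦ TangentSpace 𝓘(ℝ, E) x)]
  [FiniteDimensional ℝ E] [FiniteDimensional ℝ F]

theorem IsLocalParam.isParallelOn {φ : F → M} {U : Set F} (hφ : IsLocalParam E φ U) {s : Set ℝ}
    (hs : UniqueDiffOn ℝ s) {γ : ℝ → M} {V : ∀ t, TangentSpace 𝓘(ℝ, E) (γ t)} {x ξ x' : ℝ → F}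
    (hxU : ∀ t ∈ s, x t ∈ U) (hx : ∀ t ∈ s, HasDerivWithinAt x (x' t) s t)
    (hξ : ∀ t ∈ s, HasDerivWithinAt ξ
      (-christoffelMap (pullbackMetric (E := E) φ) (x t) (x' t) (ξ t)) s t)
    (hV : ∀ t ∈ s, (⟨γ t, V t⟩ : TangentBundle 𝓘(ℝ, E) M) =
      tangentMap 𝓘(ℝ, F) 𝓘(ℝ, E) φ ⟨x t, ξ t⟩) : IsParallelOn s γ V := by
  constructor
  · have h1 : MDifferentiableOn 𝓘(ℝ, ℝ) (𝓘(ℝ, F).prod 𝓘(ℝ, F)) (fun t ↦ (x t, ξ t)) s :=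
      fun t ht ↦ MDifferentiableWithinAt.prodMk
        (hx t ht).differentiableWithinAt.mdifferentiableWithinAt
        (hξ t ht).differentiableWithinAt.mdifferentiableWithinAt
    exact (((contMDiffOn_tangentMap hφ.isOpen hφ.contMDiffOn).mdifferentiableOn (by simp)).comp h1
      (fun t ht ↦ ⟨hxU t ht, mem_univ _⟩)).congr hV
  · intro t ht
    refine (hφ.covDerivAlong_eq_zero_iff (hs t ht) ht (hxU t ht) (hx t ht) (hξ t ht) ?_).2
      (neg_add_cancel _)
    filter_upwards [self_mem_nhdsWithin] with r hr using hV r hr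

end Transport

/-! ### Parallel transport along rays and its continuity -/

section NormalTransport

variable {E : Type*} [NormedAddCommGroup E] [NormedSpace ℝ E]
  {F : Type*} [NormedAddCommGroup F] [InnerProductSpace ℝ F]
  {M : Type*} [MetricSpace M] [ChartedSpace E M] [IsManifold 𝓘(ℝ, E) ∞ M]
  [RiemannianBundle (fun x : M ↦ TangentSpace 𝓘(ℝ, E) x)]
  [IsContMDiffRiemannianBundle 𝓘(ℝ, E) ∞ E (fun x : M ↦ TangentSpace 𝓘(ℝ, E) x)]
  [FiniteDimensional ℝ F] {Φ : PartialDiffeomorph 𝓘(ℝ, F) 𝓘(ℝ, E) F M ∞} {r : ℝ}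

/-- These are the coefficients of the transport equation along the ray to `y`, with `y` as
parameter. -/
theorem IsNormalChart.continuousOn_christoffelMap (h : IsNormalChart Φ r) :
    ContinuousOn (Function.uncurry
      (fun (y : F) (t : ℝ) ↦ -christoffelMap (pullbackMetric (E := E) Φ) (t • y) y))
      (Metric.ball 0 r ×ˢ Icc 0 1) := by
  have : CompleteSpace F := FiniteDimensional.complete ℝ F
  rintro ⟨y, t⟩ ⟨hy, ht⟩
  have hyt := smul_mem_ball hy ht
  have h1 := contDiffAt_christoffelMap (a := y)
    (h.isLocalParam.contDiffOn_pullbackMetric.contDiffAt (h.isLocalParam.isOpen.mem_nhds hyt))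
    (isInvertible_pullbackMetric (h.isLocalParam.isInvertible _ hyt))
  have h2 : ContinuousAt (fun p : F × ℝ ↦ (p.2 • p.1, p.1)) (y, t) := by fun_prop
  exact (ContinuousAt.comp (f := fun p : F × ℝ ↦ (p.2 • p.1, p.1)) (x := (y, t))
    h1.continuousAt h2).neg.continuousWithinAt

variable [FiniteDimensional ℝ E]

/-- The converse of `IsLocalParam.isParallelOn`: applying the differential of `Φ.symm` to `V` gives
a solution of the linear equation, so uniqueness for the equation yields uniqueness of the
transport. -/
theorem IsParallelOn.exists_components {s : Set ℝ} (hs : UniqueDiffOn ℝ s) {γ : ℝ → M}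
    {V : ∀ t, TangentSpace 𝓘(ℝ, E) (γ t)} (hV : IsParallelOn s γ V) {x x' : ℝ → F}
    (hxU : ∀ t ∈ s, x t ∈ Φ.source) (hx : ∀ t ∈ s, HasDerivWithinAt x (x' t) s t)
    (hγ : ∀ t ∈ s, γ t = Φ (x t)) :
    ∃ ξ : ℝ → F, (∀ t ∈ s, (⟨γ t, V t⟩ : TangentBundle 𝓘(ℝ, E) M) =
        tangentMap 𝓘(ℝ, F) 𝓘(ℝ, E) Φ ⟨x t, ξ t⟩) ∧
      ∀ t ∈ s, HasDerivWithinAt ξ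
        (-christoffelMap (pullbackMetric (E := E) Φ) (x t) (x' t) (ξ t)) s t := by
  have hmem : ∀ t ∈ s, γ t ∈ Φ.target := fun t ht ↦ by
    rw [hγ t ht]; exact Φ.map_source (hxU t ht)
  set ξ : ℝ → F := fun t ↦ mfderiv 𝓘(ℝ, E) 𝓘(ℝ, F) Φ.symm (γ t) (V t) with hξdef
  have hΦ := isLocalParam_partialDiffeomorph (E := E) Φ
  have hcomp : ∀ t ∈ s, (⟨γ t, V t⟩ : TangentBundle 𝓘(ℝ, E) M) =
        tangentMap 𝓘(ℝ, F) 𝓘(ℝ, E) Φ ⟨x t, ξ t⟩ := by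
    intro t ht
    have hx0 : Φ.symm (γ t) = x t := by
      rw [hγ t ht]; exact Φ.left_inv (hxU t ht)
    have h1 : MDifferentiableAt 𝓘(ℝ, E) 𝓘(ℝ, F) Φ.symm (γ t) :=
      (Φ.contMDiffOn_invFun.contMDiffAt
        (Φ.open_target.mem_nhds (hmem t ht))).mdifferentiableAt (by simp)
    have h2 : MDifferentiableAt 𝓘(ℝ, F) 𝓘(ℝ, E) Φ (Φ.symm (γ t)) := by
      rw [hx0]; exact hΦ.mdifferentiableAt (hxU t ht)
    have h3 : (Φ ∘ Φ.symm) =ᶠ[𝓝 (γ t)] id := by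
      filter_upwards [Φ.open_target.mem_nhds (hmem t ht)] with q hq using Φ.right_inv hq
    have h4 := tangentMap_comp_at (I := 𝓘(ℝ, E)) (I' := 𝓘(ℝ, F)) (I'' := 𝓘(ℝ, E))
      (f := Φ.symm) (g := Φ) (⟨γ t, V t⟩ : TangentBundle 𝓘(ℝ, E) M) h2 h1
    have h5 : tangentMap 𝓘(ℝ, E) 𝓘(ℝ, E) (Φ ∘ Φ.symm) (⟨γ t, V t⟩ : TangentBundle 𝓘(ℝ, E) M)
        = ⟨γ t, V t⟩ := by
      rw [tangentMap, h3.mfderiv_eq, mfderiv_id]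
      exact (mk_eq_of_proj_eq (v := (⟨(Φ ∘ Φ.symm) (γ t), (V t : E)⟩ : TangentBundle 𝓘(ℝ, E) M))
        h3.eq_of_nhds).symm
    rw [h5] at h4
    rw [h4, ← hx0]
    rfl
  have hdiff : ∀ t ∈ s, DifferentiableWithinAt ℝ ξ s t := by
    have h1 : ContMDiffOn 𝓘(ℝ, E).tangent 𝓘(ℝ, F).tangent ∞
        (tangentMapWithin 𝓘(ℝ, E) 𝓘(ℝ, F) Φ.symm Φ.target)
        (π E (TangentSpace 𝓘(ℝ, E)) ⁻¹' Φ.target) :=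
      Φ.contMDiffOn_invFun.contMDiffOn_tangentMapWithin (by simp) Φ.open_target.uniqueMDiffOn
    have h2 := (h1.mdifferentiableOn (by simp)).comp hV.1 hmem
    have h3 := (contMDiff_snd_tangentBundle_modelSpace (n := ∞) F 𝓘(ℝ, F)).mdifferentiable
      (by simp) |>.comp_mdifferentiableOn h2
    have heq : ∀ r ∈ s, ξ r = (tangentMapWithin 𝓘(ℝ, E) 𝓘(ℝ, F) Φ.symm Φ.target
        (⟨γ r, V r⟩ : TangentBundle 𝓘(ℝ, E) M)).2 := by
      intro r hr
      have : mfderivWithin 𝓘(ℝ, E) 𝓘(ℝ, F) Φ.symm Φ.target (γ r) =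
        mfderiv 𝓘(ℝ, E) 𝓘(ℝ, F) Φ.symm (γ r) := mfderivWithin_of_isOpen Φ.open_target (hmem r hr)
      exact (congrArg (fun L : E →L[ℝ] F ↦ L (V r)) this).symm
    intro t ht
    have h4 := mdifferentiableWithinAt_iff_differentiableWithinAt.1 (h3 t ht)
    exact DifferentiableWithinAt.congr h4 heq (heq t ht)
  refine ⟨ξ, hcomp, fun t ht ↦ ?_⟩
  have h1 := (hdiff t ht).hasDerivWithinAt
  have h2 := (hΦ.covDerivAlong_eq_zero_iff (hs t ht) ht (hxU t ht) (hx t ht) h1 (by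
    filter_upwards [self_mem_nhdsWithin] with r hr using hcomp r hr)).1 (hV.2 t ht)
  rwa [eq_neg_of_add_eq_zero_left h2] at h1

variable [IsRiemannianManifold 𝓘(ℝ, E) M]

/-- Parallel transport along rays in normal coordinates, in terms of the components. -/
theorem IsNormalChart.isTransportOf_iff (h : IsNormalChart Φ r) {y : F}
    (hy : y ∈ Metric.ball (0 : F) r) {p q : M} (hp : p = Φ 0) (hq : q = Φ y)
    {u : TangentSpace 𝓘(ℝ, E) p} {u₀ : F}
    (hu : (⟨p, u⟩ : TangentBundle 𝓘(ℝ, E) M) = tangentMap 𝓘(ℝ, F) 𝓘(ℝ, E) Φ ⟨0, u₀⟩)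
    {ξ : ℝ → F} (hξ0 : ξ 0 = u₀)
    (hξ : ∀ t ∈ Icc (0 : ℝ) 1, HasDerivWithinAt ξ
      (-christoffelMap (pullbackMetric (E := E) Φ) (t • y) y (ξ t)) (Icc 0 1) t)
    {w : TangentSpace 𝓘(ℝ, E) q} :
    IsTransportOf p q u w ↔
      (⟨q, w⟩ : TangentBundle 𝓘(ℝ, E) M) = tangentMap 𝓘(ℝ, F) 𝓘(ℝ, E) Φ ⟨y, ξ 1⟩ := by
  have hI : UniqueDiffOn ℝ (Icc (0 : ℝ) 1) := uniqueDiffOn_Icc zero_lt_one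
  have hx : ∀ t ∈ Icc (0 : ℝ) 1, HasDerivWithinAt (fun t : ℝ ↦ t • y) y (Icc 0 1) t :=
    fun t _ ↦ by simpa using ((hasDerivAt_id t).smul_const y).hasDerivWithinAt
  have h0I : (0 : ℝ) ∈ Icc (0 : ℝ) 1 := ⟨le_rfl, zero_le_one⟩
  have h1I : (1 : ℝ) ∈ Icc (0 : ℝ) 1 := ⟨zero_le_one, le_rfl⟩
  constructor
  · rintro ⟨γ, V, hγ, hV, hV0, hV1⟩
    rw [hp, hq, h.isMinimalGeodesic_iff hy] at hγ
    obtain ⟨η, hη, hη'⟩ := hV.exists_components hI (x := fun t : ℝ ↦ t • y) (x' := fun _ ↦ y)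
      (Φ := Φ) (fun t ht ↦ h.source_eq ▸ smul_mem_ball hy ht) hx
      (fun t ht ↦ hγ.2 t (smul_mem_ball hy ht))
    have hη0 : η 0 = ξ 0 := by
      have e : (⟨γ 0, V 0⟩ : TangentBundle 𝓘(ℝ, E) M) =
        tangentMap 𝓘(ℝ, F) 𝓘(ℝ, E) Φ ⟨(0 : ℝ) • y, η 0⟩ := hη 0 h0I
      rw [zero_smul] at e
      rw [hV0, hu] at e
      rw [hξ0]
      exact ((h.isLocalParam.isInvertible 0 (Metric.mem_ball_self h.pos)).injective
        (TotalSpace.mk_inj.1 e)).symm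
    have hA : ContinuousOn
        (fun t : ℝ ↦ -christoffelMap (pullbackMetric (E := E) Φ) (t • y) y) (Icc 0 1) :=
      h.continuousOn_christoffelMap.comp (f := fun t : ℝ ↦ (y, t))
        (by fun_prop) (fun t ht ↦ ⟨hy, ht⟩)
    have e := eqOn_of_linear_ode hA hη' hξ hη0 h1I
    have e1 : (⟨γ 1, V 1⟩ : TangentBundle 𝓘(ℝ, E) M) =
      tangentMap 𝓘(ℝ, F) 𝓘(ℝ, E) Φ ⟨(1 : ℝ) • y, η 1⟩ := hη 1 h1I
    rw [one_smul] at e1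
    rw [← hV1, e1, e]
  · intro hw
    obtain ⟨γ, hγ, -⟩ := h.existsUnique_isMinimalGeodesic hy
    have hγ' := (h.isMinimalGeodesic_iff hy).1 hγ
    let V : ∀ t, TangentSpace 𝓘(ℝ, E) (γ t) :=
      fun t ↦ (mfderiv 𝓘(ℝ, F) 𝓘(ℝ, E) Φ (t • y) (ξ t) : E)
    have hV : ∀ t ∈ Icc (0 : ℝ) 1, (⟨γ t, V t⟩ : TangentBundle 𝓘(ℝ, E) M) =
        tangentMap 𝓘(ℝ, F) 𝓘(ℝ, E) Φ ⟨t • y, ξ t⟩ := fun t ht ↦ by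
      have e := hγ'.2 t (smul_mem_ball hy ht)
      change TotalSpace.mk' E (E := fun x : M ↦ TangentSpace 𝓘(ℝ, E) x) (γ t)
        (mfderiv 𝓘(ℝ, F) 𝓘(ℝ, E) Φ (t • y) (ξ t) : E) = _
      rw [e]
      rfl
    refine ⟨γ, V, hp ▸ hq ▸ hγ, h.isLocalParam.isParallelOn hI
      (fun t ht ↦ smul_mem_ball hy ht) hx hξ hV, ?_, ?_⟩
    · rw [hV 0 h0I, hu, hξ0, zero_smul]
    · rw [hV 1 h1I, hw, one_smul]

theorem IsNormalChart.existsUnique_isTransportOf_and_continuousOn (h : IsNormalChart Φ r) {p : M}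
    (hp : p = Φ 0) {u : TangentSpace 𝓘(ℝ, E) p} {u₀ : F}
    (hu : (⟨p, u⟩ : TangentBundle 𝓘(ℝ, E) M) = tangentMap 𝓘(ℝ, F) 𝓘(ℝ, E) Φ ⟨0, u₀⟩) :
    (∀ q ∈ Φ.target, ∃! w : TangentSpace 𝓘(ℝ, E) q, IsTransportOf p q u w) ∧
    ContinuousOn (fun q : M ↦ (⟨q, parallelTransport p q u⟩ : TangentBundle 𝓘(ℝ, E) M))
      Φ.target := by
  -- The membership condition sits inside the existential so that `choose` yields one total family;
  -- off the ball its value is irrelevant.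
  have hsol : ∀ y : F, ∃ ξ : ℝ → F, y ∈ Metric.ball (0 : F) r → ξ 0 = u₀ ∧
      ∀ t ∈ Icc (0 : ℝ) 1, HasDerivWithinAt ξ
        (-christoffelMap (pullbackMetric (E := E) Φ) (t • y) y (ξ t)) (Icc 0 1) t := by
    intro y
    by_cases hy : y ∈ Metric.ball (0 : F) r
    · obtain ⟨ξ, hξ⟩ := exists_solution_linear_ode
        (A := fun t : ℝ ↦ -christoffelMap (pullbackMetric (E := E) Φ) (t • y) y)
        (h.continuousOn_christoffelMap.comp (f := fun t : ℝ ↦ (y, t))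
          (by fun_prop) (fun t ht ↦ ⟨hy, ht⟩)) u₀
      exact ⟨ξ, fun _ ↦ hξ⟩
    · exact ⟨0, fun hy' ↦ absurd hy' hy⟩
  choose ξ hξ using hsol
  have hsymm {q : M} (hq : q ∈ Φ.target) : Φ.symm q ∈ Metric.ball (0 : F) r :=
    h.source_eq ▸ Φ.map_target hq
  have hiff {q : M} (hq : q ∈ Φ.target) (w : TangentSpace 𝓘(ℝ, E) q) :=
    h.isTransportOf_iff (hsymm hq) hp (Φ.right_inv hq).symm hu (hξ _ (hsymm hq)).1
      (hξ _ (hsymm hq)).2 (w := w)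
  have hex : ∀ q ∈ Φ.target, ∃! w : TangentSpace 𝓘(ℝ, E) q, IsTransportOf p q u w := by
    intro q hq
    refine ⟨(mfderiv 𝓘(ℝ, F) 𝓘(ℝ, E) Φ (Φ.symm q) (ξ (Φ.symm q) 1) : E), ?_, fun w hw ↦ ?_⟩
    · exact (hiff hq _).2 (mk_eq_of_proj_eq (v := tangentMap 𝓘(ℝ, F) 𝓘(ℝ, E) Φ
        ⟨Φ.symm q, ξ (Φ.symm q) 1⟩) (Φ.right_inv hq))
    · have e := (hiff hq w).1 hw
      exact congrArg (fun v : TangentBundle 𝓘(ℝ, E) M ↦ (v.2 : E)) e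
  refine ⟨hex, ?_⟩
  have hode : ContinuousOn (fun y : F ↦ ξ y 1) (Metric.ball 0 r) :=
    continuousOn_linear_ode h.continuousOn_christoffelMap (fun y hy ↦ (hξ y hy).1)
      (fun y hy ↦ (hξ y hy).2)
  have hs : ContinuousOn Φ.symm Φ.target := Φ.contMDiffOn_invFun.continuousOn
  have hc := (contMDiffOn_tangentMap h.isLocalParam.isOpen
    h.isLocalParam.contMDiffOn).continuousOn.comp
    (f := fun q : M ↦ (Φ.symm q, ξ (Φ.symm q) 1)) (s := Φ.target)
    (hs.prodMk (hode.comp hs fun q hq ↦ hsymm hq)) (fun q hq ↦ ⟨hsymm hq, mem_univ _⟩)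
  refine hc.congr fun q hq ↦ ?_
  have hpt : IsTransportOf p q u (parallelTransport p q u) := by
    unfold parallelTransport
    rw [dif_pos (hex q hq).exists]
    exact (hex q hq).exists.choose_spec
  exact (hiff hq _).1 hpt

end NormalTransport

/-! ### The exponential map as a normal chart -/

section Exponential

variable {E : Type*} [NormedAddCommGroup E] [NormedSpace ℝ E]
  {M : Type*} [MetricSpace M] [ChartedSpace E M] [IsManifold 𝓘(ℝ, E) ∞ M]
  [RiemannianBundle (fun x : M ↦ TangentSpace 𝓘(ℝ, E) x)]
  [IsContMDiffRiemannianBundle 𝓘(ℝ, E) ∞ E (fun x : M ↦ TangentSpace 𝓘(ℝ, E) x)]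
  [FiniteDimensional ℝ E]

theorem IsGeodesicFrom.comp_mul {p : M} {v : TangentSpace 𝓘(ℝ, E) p} {γ : ℝ → M}
    (hγ : IsGeodesicFrom E p v γ) (c : ℝ) : IsGeodesicFrom E p (c • v) (fun t ↦ γ (c * t)) := by
  refine ⟨hγ.1.comp_mul c, ?_⟩
  have hx : HasDerivAt (fun s : ℝ ↦ c * s) c 0 := by
    simpa using (hasDerivAt_id (0 : ℝ)).const_mul c
  have h1 := mk_velocity_eq (E := E) (φ := γ) (γ := fun t ↦ γ (c * t)) (x := fun s : ℝ ↦ c * s)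
    (hγ.1.1.mdifferentiable (by simp) _) hx (Filter.EventuallyEq.refl _ _)
  have h2 : tangentMap 𝓘(ℝ, ℝ) 𝓘(ℝ, E) γ ⟨c * 0, c⟩ =
      (⟨γ 0, c • velocity γ 0⟩ : TangentBundle 𝓘(ℝ, E) M) := by
    rw [mul_zero]
    have e : c = c • (1 : ℝ) := by simp
    unfold tangentMap velocity
    simp only
    congr 1
    conv_lhs => rw [e]
    exact map_smul (mfderiv 𝓘(ℝ, ℝ) 𝓘(ℝ, E) γ 0) c (1 : ℝ)
  rw [h1, h2]
  exact congrArg (fun w : TangentBundle 𝓘(ℝ, E) M ↦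
    (⟨w.1, c • w.2⟩ : TangentBundle 𝓘(ℝ, E) M)) hγ.2

theorem IsGeodesicFrom.eq {p : M} {v : TangentSpace 𝓘(ℝ, E) p} {γ₁ γ₂ : ℝ → M}
    (h₁ : IsGeodesicFrom E p v γ₁) (h₂ : IsGeodesicFrom E p v γ₂) : γ₁ = γ₂ :=
  h₁.1.eq_of_velocity_eq h₂.1 (h₁.2.trans h₂.2.symm)

theorem IsGeodesicFrom.expMap_smul {p : M} {v : TangentSpace 𝓘(ℝ, E) p} {γ : ℝ → M}
    (hγ : IsGeodesicFrom E p v γ) (t : ℝ) : expMap E p (t • v) = γ t := by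
  have h : ∃ γ : ℝ → M, IsGeodesicFrom E p (t • v) γ := ⟨_, hγ.comp_mul t⟩
  unfold expMap
  rw [dif_pos h, h.choose_spec.eq (hγ.comp_mul t)]
  change γ (t * 1) = γ t
  rw [mul_one]

/-- Allows the tangent space, with its Riemannian inner product, to serve as the model space `F`. -/
instance finiteDimensional_tangentSpace (p : M) : FiniteDimensional ℝ (TangentSpace 𝓘(ℝ, E) p) :=
  inferInstanceAs (FiniteDimensional ℝ E)

/-- Completeness supplies a geodesic in each direction, and rescaling identifies it with `t ↦ exp (t
• v)`. Comparing velocities at `0` shows that `d exp` at the origin is the identity, hence an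
isometry. -/
theorem isNormalChart_of_eqOn_expMap (hM : IsGeodesicallyComplete E M) {p : M} {r : ℝ}
    (hr : 0 < r) {Φ : PartialDiffeomorph 𝓘(ℝ, TangentSpace 𝓘(ℝ, E) p) 𝓘(ℝ, E)
      (TangentSpace 𝓘(ℝ, E) p) M ∞} (hs : Φ.source = Metric.ball 0 r)
    (hΦ : EqOn Φ (expMap E p) (Metric.ball 0 r)) :
    IsNormalChart Φ r ∧ p = Φ 0 ∧ ∀ v : TangentSpace 𝓘(ℝ, E) p,
      (⟨p, v⟩ : TangentBundle 𝓘(ℝ, E) M) =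
        tangentMap 𝓘(ℝ, TangentSpace 𝓘(ℝ, E) p) 𝓘(ℝ, E) Φ ⟨0, v⟩ := by
  have hgeo {v : TangentSpace 𝓘(ℝ, E) p} {γ : ℝ → M} (hγ : IsGeodesicFrom E p v γ) (t : ℝ)
      (ht : t • v ∈ Metric.ball 0 r) : γ t = Φ (t • v) := by
    rw [hΦ ht, hγ.expMap_smul t]
  have h0 : (0 : TangentSpace 𝓘(ℝ, E) p) ∈ Metric.ball 0 r := Metric.mem_ball_self hr
  have hv (v : TangentSpace 𝓘(ℝ, E) p) : (⟨p, v⟩ : TangentBundle 𝓘(ℝ, E) M) =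
      tangentMap 𝓘(ℝ, TangentSpace 𝓘(ℝ, E) p) 𝓘(ℝ, E) Φ ⟨0, v⟩ := by
    obtain ⟨γ, hγ⟩ := hM p v
    have hx : HasDerivAt (fun s : ℝ ↦ s • v) v 0 := by
      simpa using (hasDerivAt_id (0 : ℝ)).smul_const v
    have h0' : (0 : ℝ) • v ∈ Metric.ball (0 : TangentSpace 𝓘(ℝ, E) p) r := by rwa [zero_smul]
    have := mk_velocity_eq (E := E) (φ := Φ) (x := fun s : ℝ ↦ s • v)
      ((isLocalParam_partialDiffeomorph Φ).mdifferentiableAt (hs ▸ h0')) hx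
      (γ := γ) (by
        filter_upwards [hx.continuousAt.preimage_mem_nhds (Metric.isOpen_ball.mem_nhds h0')]
          with s hs using hgeo hγ s hs)
    rw [hγ.2, zero_smul] at this
    exact this
  have hp : p = Φ 0 := congrArg TotalSpace.proj (hv 0)
  refine ⟨⟨hr, hs, fun a b ↦ ?_, fun v ↦ ?_⟩, hp, hv⟩
  · have e := congrArg₂ (fun x y : TangentBundle 𝓘(ℝ, E) M ↦ metricAt (E := E) x.1 x.2 y.2)
      (hv a) (hv b)
    exact e.symm
  · obtain ⟨γ, hγ⟩ := hM p v
    exact ⟨γ, hγ.1, hgeo hγ⟩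

end Exponential

end RiemTransport

end

/-! ### The main theorem -/

theorem mainTheorem2 {E : Type*} [NormedAddCommGroup E] [NormedSpace ℝ E] [FiniteDimensional ℝ E]
    {M : Type*} [MetricSpace M] [ChartedSpace E M] [IsManifold 𝓘(ℝ, E) ∞ M]
    [RiemannianBundle (fun x : M ↦ TangentSpace 𝓘(ℝ, E) x)]
    [IsContMDiffRiemannianBundle 𝓘(ℝ, E) ∞ E (fun x : M ↦ TangentSpace 𝓘(ℝ, E) x)]
    [IsRiemannianManifold 𝓘(ℝ, E) M]
    (hM : RiemTransport.IsGeodesicallyComplete E M)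
    (pbar : M) (δ : ℝ) (hδ : 0 < δ)
    (hδi : ENNReal.ofReal δ < RiemTransport.injectivityRadius E pbar)
    (u : TangentSpace 𝓘(ℝ, E) pbar) :
    (∀ p ∈ Metric.ball pbar δ,
      (∃! γ : ℝ → M, RiemTransport.IsMinimalGeodesic E pbar p γ) ∧
      (∃! w : TangentSpace 𝓘(ℝ, E) p, RiemTransport.IsTransportOf pbar p u w)) ∧
    ContinuousOn
      (fun p : M ↦
        (⟨p, RiemTransport.parallelTransport pbar p u⟩ : TangentBundle 𝓘(ℝ, E) M))
      (Metric.ball pbar δ) := by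
  -- As `δ` is strictly below a supremum, some admissible radius `r` exceeds it; no attained maximum
  -- is needed.
  obtain ⟨_, ⟨r, hr, ⟨Φ, hs, hΦ⟩, rfl⟩, hlt⟩ := lt_sSup_iff.1 hδi
  have hδr : δ < r := (ENNReal.ofReal_lt_ofReal_iff hr).1 hlt
  obtain ⟨h, hp, hu⟩ := RiemTransport.isNormalChart_of_eqOn_expMap hM hr hs hΦ
  have hy : ∀ p ∈ Metric.ball pbar δ,
      ∃ y ∈ Metric.ball (0 : TangentSpace 𝓘(ℝ, E) pbar) r, p = Φ y := fun p hpδ ↦ by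
    have hd : dist (Φ 0) p < δ := by
      rw [← hp, dist_comm]; exact hpδ
    obtain ⟨y, hyδ, hyp⟩ := h.exists_norm_lt hδr.le hd
    exact ⟨y, mem_ball_zero_iff.2 (hyδ.trans hδr), hyp⟩
  have hsub : Metric.ball pbar δ ⊆ Φ.target := fun p hpδ ↦ by
    obtain ⟨y, hyr, rfl⟩ := hy p hpδ
    exact Φ.map_source (hs ▸ hyr)
  obtain ⟨h1, h2⟩ := h.existsUnique_isTransportOf_and_continuousOn hp (hu u)
  refine ⟨fun p hpδ ↦ ⟨?_, h1 p (hsub hpδ)⟩, h2.mono hsub⟩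
  obtain ⟨y, hyr, hyp⟩ := hy p hpδ
  have h3 := h.existsUnique_isMinimalGeodesic hyr
  rwa [← hp, ← hyp] at h3
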